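/- **Setting.** Use $\hat g(\nu)=\int_{\mathbb R} g(t)e^{-2\pi i\nu t}\,dt$, extended to tempered distributions. For $g$ on $(0,\infty)$ let $\mathrm{odd}[g]$ be its odd extension to $\mathbb R$ (with value $0$ at $0$). Let $(p_j)$ be a finite or countable family of poles in $\mathbb C\setminus[0,\infty)$ (that is, $|\mathrm{ph}(-p_j)|<\pi$), with residues $r_j\in\mathbb C$ such that for some integer $m\ge 1$ $$\sum_j |r_j|\int_0^\infty \frac{dz}{(1+z)^m\,|z-p_j|}<\infty$$ (automatic for finitely many poles). Let $a_{-2},\dots,a_{N-2}\in\mathbb C$, and let $\sigma_0$ be a cross section at temperature $T_0$ (zero Kelvin: $T_0=0$) in windowed multipole form, i.e. for all $z>0$ $$z^2\sigma_0(z)=\Re_{\mathrm{conj}}\Big[\sum_j\frac{r_j}{z-p_j}\Big]+\sum_{n=0}^N a_{n-2}z^n,\qquad \Re_{\mathrm{conj}}[g](z)=\frac{g(z)+\overline{g(\bar z)}}2 .$$ Let $s_0=\mathrm{odd}[z^2\sigma_0(z)]$ be its Ferran representation. Let $k_B,A>0$, $\beta=\beta(T)=\sqrt{k_B(T-T_0)/A}$,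 and for $T>T_0$ let $s_T=\mathrm{odd}[z^2\sigma_T(z)]$, where the Doppler broadened cross section $\sigma_T$ is given by Solbrig's kernel: $$z^2\sigma_T(z)=\int_0^\infty x^2\sigma_0(x)\,\frac1{\beta\sqrt\pi}\Big[e^{-((z-x)/\beta)^2}-e^{-((z+x)/\beta)^2}\Big]dx .$$ Let $\mathcal K_T(z)=\frac1{\beta\sqrt\pi}e^{-(z/\beta)^2}$. **Theorem.** (1) $s_0$ is a tempered distribution and its Fourier transform is $$\widehat{s_0}=\frac12\Big(\sum_j r_j\widehat V_{p_j}+\sum_j\overline{r_j}\,\widehat V_{\overline{p_j}}\Big)+\sum_{n=0}^N a_{n-2}\widehat F_n ,$$ the series converging in the space of tempered distributions. The first term is what is abbreviated $\Re_{\mathrm{conj}}[\sum_j r_j\widehat V_{p_j}]$. Here, for all $n\ge0$, $\widehat F_n$ is the Fourier transform of $\mathrm{odd}[z^n]$, and $$\widehat F_{2n}(\nu)=(-1)^{n+1}\frac{2i\,(2n)!}{(2\pi\nu)^{2n+1}},\qquad \widehat F_{2n+1}=\frac{(-1)^n i}{(2\pi)^{2n+1}}\,\delta^{(2n+1)},$$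 where $\nu^{-(2n+1)}$ denotes the finite part distribution $\frac{1}{(2n)!}\frac{d^{2n}}{d\nu^{2n}}\,\mathrm{p.v.}\frac1\nu$. For every $p\in\mathbb C\setminus[0,\infty)$, $\widehat V_p$ is the Fourier transform of $\mathrm{odd}[1/(z-p)]$, both as a tempered distribution and, for each real $\nu$, as the improper integral $\lim_{R\to\infty}\int_{-R}^R$, and $$\widehat V_p(\nu)=-2i\,\mathrm{sgn}(\nu)\,f(-2\pi|\nu|p),\qquad f(z)=\mathrm{Ci}(z)\sin z-\mathrm{si}(z)\cos z,$$ with $\mathrm{si}(z)=\int_0^z\frac{\sin t}t\,dt-\frac\pi2$ and the principal branch $\mathrm{Ci}(z)=\gamma+\ln z-\int_0^z\frac{1-\cos t}t\,dt$. (2) For each $z$, $T\mapsto s_T(z)$ is smooth on $T>T_0$, and for all $k\ge0$ and $T>T_0$ the $k$-th temperature derivative is the (absolutely convergent) convolution $$\partial_T^{k}s_T=s_0\star\partial_T^{k}\mathcal K_T .$$ It is a tempered distribution and is the inverse Fourier transform of the product $\widehat{\partial_T^{k}s_T}=\widehat{s_0}\cdot\partial_T^{k}\widehat{\mathcal K_T}$,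 where, with $a=k_B/A$, $$\partial_T^{k}\widehat{\mathcal K_T}(\nu)=a^k(i\pi\nu)^{2k}\,\widehat{\mathcal K_T}(\nu)=a^k(i\pi\nu)^{2k}e^{-(\pi\beta\nu)^2}.$$ -/

import Mathlib

open MeasureTheory Filter Topology FourierTransform ComplexConjugate
open scoped SchwartzMap ContDiff

noncomputable section

namespace WMP

/-! ### Functions as tempered distributions -/

/-- A function on the line that is integrable against some weight `(1 + |x|)⁻ᵐ`; integration
against such a function is a tempered distribution. -/
def IsTempered (g : ℝ → ℂ) : Prop :=
  ∃ m : ℕ, Integrable (fun x : ℝ => ((((1 + |x|) ^ m)⁻¹ : ℝ) : ℂ) * g x)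

theorem schwartzSeminormFamily_def :
    schwartzSeminormFamily ℂ ℝ ℂ = fun m => SchwartzMap.seminorm ℂ m.1 m.2 := rfl

theorem weight_bound (m : ℕ) (φ : 𝓢(ℝ, ℂ)) (x : ℝ) :
    (1 + |x|) ^ m * ‖φ x‖ ≤
      2 ^ m * (Finset.Iic (m, 0)).sup (schwartzSeminormFamily ℂ ℝ ℂ) φ := by
  have h := SchwartzMap.one_add_le_sup_seminorm_apply (𝕜 := ℂ) (m := (m, 0)) (k := m) (n := 0)
    le_rfl le_rfl φ x
  simpa [schwartzSeminormFamily_def] using h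

theorem mul_eq_weight (g : ℝ → ℂ) (m : ℕ) (φ : 𝓢(ℝ, ℂ)) (x : ℝ) :
    φ x * g x = ((((1 + |x|) ^ m : ℝ) : ℂ) * φ x) * (((((1 + |x|) ^ m)⁻¹ : ℝ) : ℂ) * g x) := by
  have h : (((1 + |x|) ^ m : ℝ) : ℂ) ≠ 0 := by
    have : (0 : ℝ) < (1 + |x|) ^ m := by positivity
    exact_mod_cast this.ne'
  rw [Complex.ofReal_inv]
  field_simp

theorem norm_mul_le (g : ℝ → ℂ) (m : ℕ) (φ : 𝓢(ℝ, ℂ)) (x : ℝ) :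
    ‖φ x * g x‖ ≤ (2 ^ m * (Finset.Iic (m, 0)).sup (schwartzSeminormFamily ℂ ℝ ℂ) φ) *
      ‖((((1 + |x|) ^ m)⁻¹ : ℝ) : ℂ) * g x‖ := by
  rw [mul_eq_weight g m φ x, norm_mul]
  refine mul_le_mul_of_nonneg_right ?_ (norm_nonneg _)
  rw [norm_mul, Complex.norm_real, Real.norm_of_nonneg (by positivity)]
  exact weight_bound m φ x

theorem IsTempered.integrable_mul {g : ℝ → ℂ} (hg : IsTempered g) (φ : 𝓢(ℝ, ℂ)) :
    Integrable (fun x => φ x * g x) := by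
  obtain ⟨m, hm⟩ := hg
  refine (hm.norm.const_mul
    (2 ^ m * (Finset.Iic (m, 0)).sup (schwartzSeminormFamily ℂ ℝ ℂ) φ)).mono' ?_
    (Eventually.of_forall (norm_mul_le g m φ))
  have h1 : AEStronglyMeasurable (fun x : ℝ => (((1 + |x|) ^ m : ℝ) : ℂ) * φ x) := by
    refine Continuous.aestronglyMeasurable ?_
    have := φ.continuous
    fun_prop
  refine (h1.mul hm.aestronglyMeasurable).congr (Eventually.of_forall fun x => ?_)
  exact (mul_eq_weight g m φ x).symm

/-- The tempered distribution `φ ↦ ∫ φ g` of a tempered function `g`. -/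
def IsTempered.toDistribution {g : ℝ → ℂ} (hg : IsTempered g) : 𝓢'(ℝ, ℂ) :=
  ContinuousLinearMap.toPointwiseConvergenceCLM _ _ _ _
    (SchwartzMap.mkCLMtoNormedSpace (𝕜 := ℂ) (σ := RingHom.id ℂ)
      (fun φ : 𝓢(ℝ, ℂ) => ∫ x, φ x * g x)
      (fun φ ψ => by
        rw [← integral_add (hg.integrable_mul φ) (hg.integrable_mul ψ)]
        simp [add_mul])
      (fun c φ => by
        rw [RingHom.id_apply, smul_eq_mul, ← integral_const_mul]
        simp [mul_assoc])
      (by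
        obtain ⟨m, hm⟩ := hg
        refine ⟨Finset.Iic (m, 0),
          2 ^ m * ∫ x : ℝ, ‖((((1 + |x|) ^ m)⁻¹ : ℝ) : ℂ) * g x‖, by positivity, fun φ => ?_⟩
        refine (norm_integral_le_of_norm_le (hm.norm.const_mul _)
          (Eventually.of_forall (norm_mul_le g m φ))).trans ?_
        rw [integral_const_mul]
        exact le_of_eq (by ring)))

open Classical in
/-- The tempered distribution given by the function `g` (and `0` if `g` is not tempered). -/
def dist (g : ℝ → ℂ) : 𝓢'(ℝ, ℂ) :=
  if hg : IsTempered g then hg.toDistribution else 0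

theorem dist_apply {g : ℝ → ℂ} (hg : IsTempered g) (φ : 𝓢(ℝ, ℂ)) :
    dist g φ = ∫ x, φ x * g x := by
  rw [dist, dif_pos hg]
  rfl

/-! ### Negative powers of the frequency and derivatives of the delta distribution -/

theorem pv_bound (φ : 𝓢(ℝ, ℂ)) {x : ℝ} (hx : 0 < x) :
    ‖(φ x - φ (-x)) / (x : ℂ)‖ ≤
      (16 * (Finset.Iic (2, 1)).sup (schwartzSeminormFamily ℂ ℝ ℂ) φ) * (1 + x ^ 2)⁻¹ := by
  set S := (Finset.Iic (2, 1)).sup (schwartzSeminormFamily ℂ ℝ ℂ) φ with hS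
  have h0 : ∀ y : ℝ, (1 + |y|) ^ 2 * ‖φ y‖ ≤ 4 * S := fun y => by
    have h := SchwartzMap.one_add_le_sup_seminorm_apply (𝕜 := ℂ) (m := (2, 1)) (k := 2) (n := 0)
      le_rfl (Nat.zero_le _) φ y
    norm_num at h
    simpa [hS, schwartzSeminormFamily_def] using h
  have h1 : ∀ y : ℝ, ‖deriv φ y‖ ≤ 4 * S := fun y => by
    have h := SchwartzMap.one_add_le_sup_seminorm_apply (𝕜 := ℂ) (m := (2, 1)) (k := 0) (n := 1)
      (Nat.zero_le _) le_rfl φ y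
    rw [norm_iteratedFDeriv_eq_norm_iteratedDeriv, iteratedDeriv_one] at h
    norm_num at h
    simpa [hS, schwartzSeminormFamily_def] using h
  have hS0 : 0 ≤ S := by
    have := (norm_nonneg _).trans (h1 0)
    linarith
  rw [norm_div, Complex.norm_real, Real.norm_of_nonneg hx.le, div_le_iff₀ hx, mul_assoc]
  rcases le_total x 1 with hx1 | hx1
  · have hd : ‖φ x - φ (-x)‖ ≤ 4 * S * ‖x - (-x)‖ :=
      convex_univ.norm_image_sub_le_of_norm_deriv_le
        (fun y _ => φ.differentiableAt) (fun y _ => h1 y) (Set.mem_univ _) (Set.mem_univ _)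
    rw [Real.norm_of_nonneg (by linarith)] at hd
    have h2 : (1 / 2 : ℝ) ≤ (1 + x ^ 2)⁻¹ := by
      rw [one_div]
      exact inv_anti₀ (by positivity) (by nlinarith)
    have h3 : 1 / 2 * x ≤ (1 + x ^ 2)⁻¹ * x := mul_le_mul_of_nonneg_right h2 hx.le
    nlinarith [mul_le_mul_of_nonneg_left h3 hS0]
  · have hb : ∀ y : ℝ, |y| = x → ‖φ y‖ ≤ 4 * S * (1 + x ^ 2)⁻¹ := fun y hy => by
      have h := h0 y
      rw [hy] at h
      rw [← div_eq_mul_inv, le_div_iff₀ (by positivity)]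
      refine le_trans ?_ h
      rw [mul_comm]
      exact mul_le_mul_of_nonneg_right (by nlinarith) (norm_nonneg _)
    have ha := hb x (abs_of_pos hx)
    have hc := hb (-x) (by rw [abs_neg, abs_of_pos hx])
    have h4 : ‖φ x - φ (-x)‖ ≤ 8 * S * (1 + x ^ 2)⁻¹ :=
      (norm_sub_le _ _).trans (by linarith)
    have h5 : 0 ≤ S * (1 + x ^ 2)⁻¹ := by positivity
    nlinarith [mul_le_mul_of_nonneg_left hx1 h5]

theorem pv_integrable (φ : 𝓢(ℝ, ℂ)) :
    IntegrableOn (fun x : ℝ => (φ x - φ (-x)) / (x : ℂ)) (Set.Ioi 0) := by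
  refine Integrable.mono' ((integrable_inv_one_add_sq.const_mul
    (16 * (Finset.Iic (2, 1)).sup (schwartzSeminormFamily ℂ ℝ ℂ) φ)).integrableOn) ?_ ?_
  · have h1 : Measurable fun x : ℝ => φ x := φ.continuous.measurable
    have h2 : Measurable fun x : ℝ => φ (-x) := h1.comp measurable_neg
    exact ((h1.sub h2).div Complex.measurable_ofReal).aestronglyMeasurable
  · filter_upwards [ae_restrict_mem measurableSet_Ioi] with x hx
    exact pv_bound φ hx

/-- The principal value distribution `p.v. 1/ν`, that is
`φ ↦ lim_{ε → 0⁺} ∫_{|ν| > ε} φ(ν)/ν dν = ∫_0^∞ (φ(ν) - φ(-ν))/ν dν`. -/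
def pvInv : 𝓢'(ℝ, ℂ) :=
  ContinuousLinearMap.toPointwiseConvergenceCLM _ _ _ _
    (SchwartzMap.mkCLMtoNormedSpace (𝕜 := ℂ) (σ := RingHom.id ℂ)
      (fun φ : 𝓢(ℝ, ℂ) => ∫ x in Set.Ioi (0 : ℝ), (φ x - φ (-x)) / (x : ℂ))
      (fun φ ψ => by
        rw [← integral_add (pv_integrable φ) (pv_integrable ψ)]
        congr 1
        ext x
        simp only [_root_.add_apply]
        ring)
      (fun c φ => by
        rw [RingHom.id_apply, smul_eq_mul, ← integral_const_mul]
        congr 1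
        ext x
        simp only [_root_.smul_apply, smul_eq_mul]
        ring)
      ⟨Finset.Iic (2, 1), 16 * ∫ x in Set.Ioi (0 : ℝ), (1 + x ^ 2)⁻¹,
        mul_nonneg (by norm_num) (integral_nonneg fun x => by positivity), fun φ => by
        refine (norm_integral_le_of_norm_le ((integrable_inv_one_add_sq.const_mul
          (16 * (Finset.Iic (2, 1)).sup (schwartzSeminormFamily ℂ ℝ ℂ) φ)).integrableOn) ?_).trans ?_
        · filter_upwards [ae_restrict_mem measurableSet_Ioi] with x hx
          exact pv_bound φ hx
        · rw [integral_const_mul]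
          exact le_of_eq (by ring)⟩)

/-- The `k`-th distributional derivative. -/
def iterDeriv (k : ℕ) (u : 𝓢'(ℝ, ℂ)) : 𝓢'(ℝ, ℂ) :=
  (TemperedDistribution.derivCLM ℂ)^[k] u

/-- The (Hadamard finite part) distribution `1/ν^(m+1) = ((-1)^m / m!) (d/dν)^m p.v. 1/ν`. -/
def invPow (m : ℕ) : 𝓢'(ℝ, ℂ) :=
  ((-1 : ℂ) ^ m / (m.factorial : ℂ)) • iterDeriv m pvInv

/-- The distributions `F̂_n`: for `n = 2l` even, `(-1)^(l+1) 2i (2l)! / (2πν)^(2l+1)`, and for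
`n = 2l+1` odd, `(-1)^l i / (2π)^(2l+1) δ^(2l+1)`. -/
def Fhat (n : ℕ) : 𝓢'(ℝ, ℂ) :=
  if Even n then
    ((-1 : ℂ) ^ (n / 2 + 1) * (2 * Complex.I * (n.factorial : ℂ)) /
      (2 * (Real.pi : ℂ)) ^ (n + 1)) • invPow n
  else
    ((-1 : ℂ) ^ (n / 2) * Complex.I / (2 * (Real.pi : ℂ)) ^ n) •
      iterDeriv n (TemperedDistribution.delta (0 : ℝ))

/-! ### The auxiliary function of the sine and cosine integrals -/

/-- `Si(z) = ∫_0^z sin t / t dt`, along the segment from `0` to `z`. -/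
def Si (z : ℂ) : ℂ := ∫ t in (0 : ℝ)..1, Complex.sin (z * t) / (t : ℂ)

/-- `si(z) = Si(z) - π/2`. -/
def si (z : ℂ) : ℂ := Si z - (Real.pi : ℂ) / 2

/-- `Cin(z) = ∫_0^z (1 - cos t) / t dt`, along the segment from `0` to `z`. -/
def Cin (z : ℂ) : ℂ := ∫ t in (0 : ℝ)..1, (1 - Complex.cos (z * t)) / (t : ℂ)

/-- The principal branch of the cosine integral, `Ci(z) = γ + ln z - Cin(z)`. -/
def Ci (z : ℂ) : ℂ := (Real.eulerMascheroniConstant : ℂ) + Complex.log z - Cin z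

/-- The auxiliary function `f(z) = Ci(z) sin z - si(z) cos z`. -/
def auxF (z : ℂ) : ℂ := Ci z * Complex.sin z - si z * Complex.cos z

/-- `V̂_p(ν) = -2i sgn(ν) f(-2π|ν|p)`. -/
def Vhat (p : ℂ) (ν : ℝ) : ℂ :=
  -2 * Complex.I * (Real.sign ν : ℂ) * auxF (-2 * (Real.pi : ℂ) * ((|ν| : ℝ) : ℂ) * p)

/-! ### Cross sections -/

/-- The continued conjugate real part `(f(z) + f(z*)*) / 2`. -/
def reConj (f : ℂ → ℂ) (z : ℂ) : ℂ := (f z + conj (f (conj z))) / 2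

/-- The odd extension to the line of the restriction of `g` to the positive half-line. -/
def oddExt (g : ℝ → ℂ) (z : ℝ) : ℂ :=
  if 0 < z then g z else if z = 0 then 0 else -g (-z)

/-- The Ferran representation of a cross section: the odd extension of `z ↦ z² σ(z)`. -/
def ferran (σ : ℝ → ℂ) : ℝ → ℂ := oddExt fun z => (z : ℂ) ^ 2 * σ z

/-- `β = √(k_B (T - T₀) / A)`. -/
def beta (kB A T₀ T : ℝ) : ℝ := Real.sqrt (kB * (T - T₀) / A)

/-- The Maxwell-Boltzmann kernel `exp(-(z/β)²) / (β √π)`. -/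
def boltzmann (β z : ℝ) : ℂ :=
  ((1 / (β * Real.sqrt Real.pi) * Real.exp (-(z / β) ^ 2) : ℝ) : ℂ)

/-- Solbrig's kernel. -/
def solbrig (β z x : ℝ) : ℂ :=
  ((1 / (β * Real.sqrt Real.pi) *
    (Real.exp (-((z - x) / β) ^ 2) - Real.exp (-((z + x) / β) ^ 2)) : ℝ) : ℂ)

/-- The Doppler broadened cross section: `z² σ_T(z) = ∫_0^∞ x² σ(x) K(z, x) dx` with Solbrig's
kernel `K`. -/
def broadened (σ : ℝ → ℂ) (β z : ℝ) : ℂ :=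
  1 / (z : ℂ) ^ 2 * ∫ x in Set.Ioi (0 : ℝ), (x : ℂ) ^ 2 * σ x * solbrig β z x

/-- `s_T`, the Ferran representation of the cross section at temperature `T` that is the Doppler
broadening of the cross section `σ` at temperature `T₀`. -/
def sT (σ : ℝ → ℂ) (kB A T₀ T : ℝ) : ℝ → ℂ := ferran (broadened σ (beta kB A T₀ T))

/-- The Maxwell-Boltzmann kernel at temperature `T`. -/
def kernelT (kB A T₀ T : ℝ) : ℝ → ℂ := boltzmann (beta kB A T₀ T)

/-- The `k`-th temperature derivative, at temperature `T` and for each `z`, of a family of functions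
indexed by temperature. -/
def tempDeriv (k : ℕ) (F : ℝ → ℝ → ℂ) (T z : ℝ) : ℂ := iteratedDeriv k (fun T' => F T' z) T

end WMP

end

namespace WMP

/-! ### Integrability of series -/

/-! The representation `ferran σ₀` is a combination of odd extensions of resonances and monomials,
so part (1) comes down to these two transforms and an exchange of sum and transform. The hypothesis
on the residues says that the resonances are absolutely summable in one weighted L¹ space; pairing
with Schwartz functions and continuity of `𝓕` do the rest (`hasSum_dist`,
`hasSum_fourier_resonance`).

For a resonance with pole q, oddness and scaling turn the truncated Fourier integral into a multiple
of the integral of sin t / (t + z) from 0, with z = -2π|ν|q. Its primitive is cos z si(z+t) - sin z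
Ci(z+t), and si and Ci vanish at +∞, so the limit is f(z). That vanishing follows from Ein(w) - log
w → γ along the rays through 1, i and -i, which rests on Γ'(1) = -γ. One integration by parts bounds
the truncations uniformly in R and ν, hence the pointwise limit is also the distributional transform
(`fourier_dist_of_tendsto_truncFourier`).

For monomials, x^n 𝓕φ is a multiple of the transform of the n-th derivative of φ. Odd n then reduces
to Fourier inversion at 0, and even n to the sign function, whose transform is a principal value by
the Riemann–Lebesgue lemma.

For part (2), folding turns Solbrig's integral into the convolution of the odd function s₀ with an
even Gaussian, the heat kernel at time τ = β² = (k_B/A)(T - T₀). On the Fourier side ∂_τ multiplies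
by (iπν)². All τ-derivatives of the kernel are Schwartz functions with bounds uniform for τ in
compact subsets of (0, ∞), which justifies differentiation under the integral; Fubini gives the
product formula. -/

theorem ae_summable_norm_of_summable_integral_norm {α E ι : Type*} [MeasurableSpace α]
    {μ : Measure α} [NormedAddCommGroup E] [Countable ι] {F : ι → α → E}
    (hF : ∀ i, Integrable (F i) μ) (hsum : Summable fun i => ∫ x, ‖F i x‖ ∂μ) :
    (∫⁻ x, ∑' i, ‖F i x‖ₑ ∂μ) ≠ ⊤ ∧ ∀ᵐ x ∂μ, Summable fun i => ‖F i x‖ := by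
  have hfin : (∫⁻ x, ∑' i, ‖F i x‖ₑ ∂μ) ≠ ⊤ := by
    rw [lintegral_tsum fun i => (hF i).aestronglyMeasurable.enorm]
    have h : ∀ i, ∫⁻ x, ‖F i x‖ₑ ∂μ = ENNReal.ofReal (∫ x, ‖F i x‖ ∂μ) := fun i =>
      (ofReal_integral_norm_eq_lintegral_enorm (hF i)).symm
    simp_rw [h]
    rw [← ENNReal.ofReal_tsum_of_nonneg (fun i => integral_nonneg fun x => norm_nonneg _) hsum]
    exact ENNReal.ofReal_ne_top
  refine ⟨hfin, ?_⟩
  filter_upwards [ae_lt_top' (AEMeasurable.tsum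
    fun i => (hF i).aestronglyMeasurable.enorm) hfin] with x hx
  exact NNReal.summable_coe.2 (ENNReal.tsum_coe_ne_top_iff_summable.1 hx.ne)

theorem integrable_tsum_of_summable_integral_norm {α E ι : Type*} [MeasurableSpace α]
    {μ : Measure α} [NormedAddCommGroup E] [CompleteSpace E] [Countable ι] {F : ι → α → E}
    (hF : ∀ i, Integrable (F i) μ) (hsum : Summable fun i => ∫ x, ‖F i x‖ ∂μ) :
    Integrable (fun x => ∑' i, F i x) μ := by
  obtain ⟨hfin, hae⟩ := ae_summable_norm_of_summable_integral_norm hF hsum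
  refine ⟨?_, ?_⟩
  · refine aestronglyMeasurable_of_tendsto_ae (u := (atTop : Filter (Finset ι)))
      (f := fun s x => ∑ i ∈ s, F i x)
      (fun s => Finset.aestronglyMeasurable_fun_sum s fun i _ => (hF i).aestronglyMeasurable) ?_
    filter_upwards [hae] with x hx
    exact hx.of_norm.hasSum
  · refine lt_of_le_of_lt (lintegral_mono_ae ?_) hfin.lt_top
    filter_upwards [hae] with x hx
    exact enorm_tsum_le_tsum_enorm

/-! ### Operations on tempered functions -/

theorem norm_weight_mul (m : ℕ) (x : ℝ) (c : ℂ) :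
    ‖((((1 + |x|) ^ m)⁻¹ : ℝ) : ℂ) * c‖ = ((1 + |x|) ^ m)⁻¹ * ‖c‖ := by
  rw [norm_mul, Complex.norm_real, Real.norm_of_nonneg (by positivity)]

theorem measurable_weight (m : ℕ) :
    Measurable fun x : ℝ => ((((1 + |x|) ^ m)⁻¹ : ℝ) : ℂ) := by
  fun_prop

theorem integrable_weight_of_le {g : ℝ → ℂ} {m m' : ℕ} (h : m ≤ m')
    (hg : Integrable fun x : ℝ => ((((1 + |x|) ^ m)⁻¹ : ℝ) : ℂ) * g x) :
    Integrable fun x : ℝ => ((((1 + |x|) ^ m')⁻¹ : ℝ) : ℂ) * g x := by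
  have h1 : ∀ x : ℝ, ((((1 + |x|) ^ m')⁻¹ : ℝ) : ℂ) * g x =
      ((((1 + |x|) ^ (m' - m))⁻¹ : ℝ) : ℂ) * (((((1 + |x|) ^ m)⁻¹ : ℝ) : ℂ) * g x) := fun x => by
    rw [← mul_assoc, ← Complex.ofReal_mul, ← mul_inv, ← pow_add, Nat.sub_add_cancel h]
  simp_rw [h1]
  refine hg.mono ((measurable_weight _).aestronglyMeasurable.mul hg.aestronglyMeasurable)
    (Eventually.of_forall fun x => ?_)
  rw [norm_weight_mul]
  refine mul_le_of_le_one_left (norm_nonneg _) (inv_le_one_of_one_le₀ (one_le_pow₀ ?_))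
  linarith [abs_nonneg x]

theorem IsTempered.aestronglyMeasurable {g : ℝ → ℂ} (hg : IsTempered g) :
    AEStronglyMeasurable g := by
  obtain ⟨m, hm⟩ := hg
  have h : Measurable fun x : ℝ => (((1 + |x|) ^ m : ℝ) : ℂ) := by fun_prop
  refine (h.aestronglyMeasurable.mul hm.aestronglyMeasurable).congr
    (Eventually.of_forall fun x => ?_)
  have h0 : (((1 + |x|) ^ m : ℝ) : ℂ) ≠ 0 := by
    have : (0 : ℝ) < (1 + |x|) ^ m := by positivity
    exact_mod_cast this.ne'
  simp only [Pi.mul_apply, Complex.ofReal_inv]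
  field_simp

theorem IsTempered.add {g h : ℝ → ℂ} (hg : IsTempered g) (hh : IsTempered h) :
    IsTempered fun x => g x + h x := by
  obtain ⟨m, hm⟩ := hg
  obtain ⟨n, hn⟩ := hh
  refine ⟨max m n, ((integrable_weight_of_le (le_max_left m n) hm).add
    (integrable_weight_of_le (le_max_right m n) hn)).congr (Eventually.of_forall fun x => ?_)⟩
  simp [mul_add]

theorem IsTempered.const_mul {g : ℝ → ℂ} (hg : IsTempered g) (c : ℂ) :
    IsTempered fun x => c * g x := by
  obtain ⟨m, hm⟩ := hg
  refine ⟨m, (hm.const_mul c).congr (Eventually.of_forall fun x => ?_)⟩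
  ring

theorem isTempered_zero : IsTempered fun _ => 0 := ⟨0, by simp⟩

theorem IsTempered.sum {κ : Type*} (s : Finset κ) {g : κ → ℝ → ℂ}
    (hg : ∀ i ∈ s, IsTempered (g i)) : IsTempered fun x => ∑ i ∈ s, g i x := by
  classical
  induction s using Finset.induction_on with
  | empty => simpa using isTempered_zero
  | insert i s hi ih =>
    simp_rw [Finset.sum_insert hi]
    exact (hg i (Finset.mem_insert_self i s)).add
      (ih fun j hj => hg j (Finset.mem_insert_of_mem hj))

theorem integrable_inv_one_add_abs_sq : Integrable fun x : ℝ => ((1 + |x|) ^ 2)⁻¹ := by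
  have h := integrable_one_add_norm (E := ℝ) (μ := volume) (r := 2) (by simp)
  refine h.congr (Eventually.of_forall fun x => ?_)
  simp only [Real.norm_eq_abs]
  rw [Real.rpow_neg (by positivity)]
  norm_cast

theorem IsTempered.of_norm_le {g : ℝ → ℂ} (hg : AEStronglyMeasurable g) (m : ℕ) (C : ℝ)
    (h : ∀ x, ‖g x‖ ≤ C * (1 + |x|) ^ m) : IsTempered g := by
  -- The two extra powers leave the integrable factor (1 + |x|)⁻².
  refine ⟨m + 2, (integrable_inv_one_add_abs_sq.const_mul C).mono'
    ((measurable_weight _).aestronglyMeasurable.mul hg) (Eventually.of_forall fun x => ?_)⟩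
  rw [norm_weight_mul, pow_add, mul_inv]
  have h1 : 0 < (1 + |x|) ^ m := by positivity
  have h2 : 0 < ((1 + |x|) ^ 2)⁻¹ := by positivity
  calc ((1 + |x|) ^ m)⁻¹ * ((1 + |x|) ^ 2)⁻¹ * ‖g x‖
      ≤ ((1 + |x|) ^ m)⁻¹ * ((1 + |x|) ^ 2)⁻¹ * (C * (1 + |x|) ^ m) := by gcongr; exact h x
    _ = C * ((1 + |x|) ^ 2)⁻¹ := by field_simp

theorem dist_add {g h : ℝ → ℂ} (hg : IsTempered g) (hh : IsTempered h) :
    dist (fun x => g x + h x) = dist g + dist h := by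
  ext φ
  rw [_root_.add_apply, dist_apply (hg.add hh), dist_apply hg, dist_apply hh,
    ← integral_add (hg.integrable_mul φ) (hh.integrable_mul φ)]
  simp [mul_add]

theorem dist_const_mul {g : ℝ → ℂ} (hg : IsTempered g) (c : ℂ) :
    dist (fun x => c * g x) = c • dist g := by
  ext φ
  rw [_root_.smul_apply, dist_apply (hg.const_mul c), dist_apply hg, smul_eq_mul,
    ← integral_const_mul]
  congr 1
  ext x
  ring

theorem dist_zero : dist (fun _ => 0) = 0 := by
  ext φ
  rw [dist_apply isTempered_zero]
  simp

theorem dist_sum {κ : Type*} (s : Finset κ) {g : κ → ℝ → ℂ} (hg : ∀ i ∈ s, IsTempered (g i)) :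
    dist (fun x => ∑ i ∈ s, g i x) = ∑ i ∈ s, dist (g i) := by
  classical
  induction s using Finset.induction_on with
  | empty => simpa using dist_zero
  | insert i s hi ih =>
    have hs : ∀ j ∈ s, IsTempered (g j) := fun j hj => hg j (Finset.mem_insert_of_mem hj)
    simp_rw [Finset.sum_insert hi]
    rw [dist_add (hg i (Finset.mem_insert_self i s)) (IsTempered.sum s hs), ih hs]

theorem isTempered_tsum {ι : Type*} [Countable ι] {F : ι → ℝ → ℂ} {m : ℕ}
    (hF : ∀ j, Integrable fun x : ℝ => ((((1 + |x|) ^ m)⁻¹ : ℝ) : ℂ) * F j x)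
    (hsum : Summable fun j => ∫ x : ℝ, ‖((((1 + |x|) ^ m)⁻¹ : ℝ) : ℂ) * F j x‖) :
    IsTempered fun x => ∑' j, F j x := by
  refine ⟨m, (integrable_tsum_of_summable_integral_norm hF hsum).congr
    (Eventually.of_forall fun x => ?_)⟩
  exact tsum_mul_left

/-- Convergence in the space of distributions is tested on each φ separately. Since all terms share
the exponent m, a single seminorm of φ bounds every pairing by the weighted L¹ norm of the term. -/
theorem hasSum_dist {ι : Type*} [Countable ι] {F : ι → ℝ → ℂ} {m : ℕ}
    (hF : ∀ j, Integrable fun x : ℝ => ((((1 + |x|) ^ m)⁻¹ : ℝ) : ℂ) * F j x)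
    (hsum : Summable fun j => ∫ x : ℝ, ‖((((1 + |x|) ^ m)⁻¹ : ℝ) : ℂ) * F j x‖) :
    HasSum (fun j => dist (F j)) (dist fun x => ∑' j, F j x) := by
  refine PointwiseConvergenceCLM.tendsto_iff_forall_tendsto.2 fun φ => ?_
  have hT : ∀ j, IsTempered (F j) := fun j => ⟨m, hF j⟩
  have h := hasSum_integral_of_summable_integral_norm (F := fun j x => φ x * F j x)
    (fun j => (hT j).integrable_mul φ) (by
      refine Summable.of_nonneg_of_le (fun j => integral_nonneg fun x => norm_nonneg _)
        (fun j => ?_)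
        (hsum.mul_left (2 ^ m * (Finset.Iic (m, 0)).sup (schwartzSeminormFamily ℂ ℝ ℂ) φ))
      rw [← integral_const_mul]
      exact integral_mono ((hT j).integrable_mul φ).norm ((hF j).norm.const_mul _)
        fun x => norm_mul_le (F j) m φ x)
  rw [dist_apply (isTempered_tsum hF hsum)]
  simp_rw [tsum_mul_left] at h
  refine h.congr fun s => ?_
  rw [_root_.sum_apply]
  exact Finset.sum_congr rfl fun j _ => (dist_apply (hT j) φ).symm

/-! ### Logarithmic primitives `∫_0^z g(t)/t dt` -/

/-- Removes the singularity at t = 0: the right-hand side is continuous in t when g is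
differentiable. -/
theorem div_eq_mul_dslope {g : ℂ → ℂ} (hg0 : g 0 = 0) (z : ℂ) {t : ℝ} (ht : t ≠ 0) :
    g (z * t) / (t : ℂ) = z * dslope g 0 (z * t) := by
  have h := sub_smul_dslope g 0 (z * t)
  rw [hg0, sub_zero, sub_zero, smul_eq_mul] at h
  have ht' : (t : ℂ) ≠ 0 := by exact_mod_cast ht
  rw [div_eq_iff ht', ← h]
  ring

theorem intervalIntegrable_div {g : ℂ → ℂ} (hg : Differentiable ℂ g) (hg0 : g 0 = 0) (z : ℂ) :
    IntervalIntegrable (fun t : ℝ => g (z * t) / (t : ℂ)) volume 0 1 := by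
  have hc : Continuous (dslope g 0) := by
    rw [← continuousOn_univ, continuousOn_dslope Filter.univ_mem]
    exact ⟨hg.continuous.continuousOn, hg 0⟩
  have h : Continuous fun t : ℝ => z * dslope g 0 (z * t) := by fun_prop
  refine (h.intervalIntegrable 0 1).congr fun t ht => ?_
  rw [Set.uIoc_of_le zero_le_one] at ht
  exact (div_eq_mul_dslope hg0 z ht.1.ne').symm

/-- The chain rule produces a factor t that cancels the denominator, so the differentiated integrand
is bounded by the maximum of g' on a closed ball. -/
theorem hasDerivAt_integral_div {g g' : ℂ → ℂ} (hg : ∀ z, HasDerivAt g (g' z) z)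
    (hg' : Continuous g') (hg0 : g 0 = 0) (z : ℂ) :
    HasDerivAt (fun z => ∫ t in (0 : ℝ)..1, g (z * t) / (t : ℂ))
      (∫ t in (0 : ℝ)..1, g' (z * t)) z := by
  have hgd : Differentiable ℂ g := fun z => (hg z).differentiableAt
  obtain ⟨C, hC⟩ := (isCompact_closedBall (0 : ℂ) (‖z‖ + 1)).exists_bound_of_continuousOn
    hg'.continuousOn
  refine (intervalIntegral.hasDerivAt_integral_of_dominated_loc_of_deriv_le
    (F := fun (z : ℂ) (t : ℝ) => g (z * t) / (t : ℂ)) (F' := fun (z : ℂ) (t : ℝ) => g' (z * t))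
    (bound := fun _ => C) (Metric.ball_mem_nhds z one_pos) ?_ ?_ ?_ ?_ ?_ ?_).2
  · refine Eventually.of_forall fun w => ?_
    rw [Set.uIoc_of_le zero_le_one]
    exact (intervalIntegrable_div hgd hg0 w).1.aestronglyMeasurable
  · exact intervalIntegrable_div hgd hg0 z
  · have h : Continuous fun t : ℝ => g' (z * t) := by fun_prop
    exact h.aestronglyMeasurable
  · refine Eventually.of_forall fun t ht w hw => hC _ ?_
    rw [Set.uIoc_of_le zero_le_one] at ht
    rw [mem_closedBall_zero_iff, norm_mul, Complex.norm_real, Real.norm_of_nonneg ht.1.le]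
    have h1 : ‖w‖ ≤ ‖z‖ + 1 := by
      have h2 : ‖w - z‖ < 1 := by simpa [dist_eq_norm] using Metric.mem_ball.1 hw
      have h3 := norm_add_le (w - z) z
      rw [sub_add_cancel] at h3
      linarith
    calc ‖w‖ * t ≤ ‖w‖ * 1 := by gcongr; exact ht.2
      _ ≤ ‖z‖ + 1 := by linarith
  · exact intervalIntegrable_const
  · refine Eventually.of_forall fun t ht w _ => ?_
    rw [Set.uIoc_of_le zero_le_one] at ht
    have ht' : (t : ℂ) ≠ 0 := by exact_mod_cast ht.1.ne'
    have h := ((hg (w * t)).comp w ((hasDerivAt_id w).mul_const (t : ℂ))).div_const (t : ℂ)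
    refine h.congr_deriv ?_
    field_simp

theorem integral_deriv_mul {g g' : ℂ → ℂ} (hg : ∀ z, HasDerivAt g (g' z) z)
    (hg' : Continuous g') (hg0 : g 0 = 0) {z : ℂ} (hz : z ≠ 0) :
    ∫ t in (0 : ℝ)..1, g' (z * t) = g z / z := by
  have h := intervalIntegral.integral_eq_sub_of_hasDerivAt (a := 0) (b := 1)
    (f := fun t : ℝ => g (z * t) / z) (f' := fun t : ℝ => g' (z * t)) (fun t _ => by
      have h1 := ((hg (z * t)).comp (t : ℂ) ((hasDerivAt_id (t : ℂ)).const_mul z)).div_const z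
      refine h1.comp_ofReal.congr_deriv ?_
      field_simp) (by
      have h : Continuous fun t : ℝ => g' (z * t) := by fun_prop
      exact h.intervalIntegrable 0 1)
  rw [h]
  simp [hg0]

theorem hasDerivAt_integral_div' {g g' : ℂ → ℂ} (hg : ∀ z, HasDerivAt g (g' z) z)
    (hg' : Continuous g') (hg0 : g 0 = 0) {z : ℂ} (hz : z ≠ 0) :
    HasDerivAt (fun z => ∫ t in (0 : ℝ)..1, g (z * t) / (t : ℂ)) (g z / z) z := by
  rw [← integral_deriv_mul hg hg' hg0 hz]
  exact hasDerivAt_integral_div hg hg' hg0 z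

/-- `Ein(z) = ∫_0^z (1 - e⁻ᵗ) / t dt`, along the segment from `0` to `z`. -/
noncomputable def Ein (z : ℂ) : ℂ := ∫ t in (0 : ℝ)..1, (1 - Complex.exp (-(z * t))) / (t : ℂ)

theorem hasDerivAt_one_sub_exp_neg (z : ℂ) :
    HasDerivAt (fun z => 1 - Complex.exp (-z)) (Complex.exp (-z)) z := by
  simpa using ((hasDerivAt_neg z).cexp).const_sub 1

theorem hasDerivAt_one_sub_cos (z : ℂ) :
    HasDerivAt (fun z => 1 - Complex.cos z) (Complex.sin z) z := by
  simpa using (Complex.hasDerivAt_cos z).const_sub 1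

theorem differentiable_Ein : Differentiable ℂ Ein := fun z =>
  (hasDerivAt_integral_div hasDerivAt_one_sub_exp_neg (by fun_prop) (by simp) z).differentiableAt

theorem hasDerivAt_Ein {z : ℂ} (hz : z ≠ 0) :
    HasDerivAt Ein ((1 - Complex.exp (-z)) / z) z :=
  hasDerivAt_integral_div' hasDerivAt_one_sub_exp_neg (by fun_prop) (by simp) hz

theorem hasDerivAt_Si {z : ℂ} (hz : z ≠ 0) : HasDerivAt Si (Complex.sin z / z) z :=
  hasDerivAt_integral_div' Complex.hasDerivAt_sin (by fun_prop) (by simp) hz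

theorem hasDerivAt_Cin {z : ℂ} (hz : z ≠ 0) : HasDerivAt Cin ((1 - Complex.cos z) / z) z :=
  hasDerivAt_integral_div' hasDerivAt_one_sub_cos (by fun_prop) (by simp) hz

theorem hasDerivAt_si {z : ℂ} (hz : z ≠ 0) : HasDerivAt si (Complex.sin z / z) z :=
  (hasDerivAt_Si hz).sub_const _

theorem hasDerivAt_Ci {z : ℂ} (hz : z ∈ Complex.slitPlane) :
    HasDerivAt Ci (Complex.cos z / z) z := by
  have h0 := Complex.slitPlane_ne_zero hz
  have h := ((Complex.hasDerivAt_log hz).const_add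
    (Real.eulerMascheroniConstant : ℂ)).sub (hasDerivAt_Cin h0)
  refine h.congr_deriv ?_
  field_simp
  ring

/-- Euler's formula in the integrand. This converts the behaviour of `Ein` on the imaginary axis
into that of `Ci` and `si` on the real axis. -/
theorem Ein_mul_I (z : ℂ) : Ein (z * Complex.I) = Cin z + Complex.I * Si z := by
  rw [Ein, Cin, Si, ← intervalIntegral.integral_const_mul, ← intervalIntegral.integral_add]
  · congr 1
    ext t
    have h : -(z * Complex.I * t) = -(z * t) * Complex.I := by ring
    rw [h, Complex.exp_mul_I, Complex.cos_neg, Complex.sin_neg]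
    ring
  · exact intervalIntegrable_div (g := fun z => 1 - Complex.cos z) (by fun_prop) (by simp) z
  · exact (intervalIntegrable_div Complex.differentiable_sin (by simp) z).const_mul _

theorem Cin_neg (z : ℂ) : Cin (-z) = Cin z := by simp [Cin]

theorem Si_neg (z : ℂ) : Si (-z) = -Si z := by
  simp [Si, neg_div]

/-! ### Behaviour at infinity -/

/-- Both sides are Γ'(1), the left one by differentiating Euler's integral. -/
theorem integral_log_mul_exp_neg :
    ∫ t in Set.Ioi (0 : ℝ), ((Real.log t * Real.exp (-t) : ℝ) : ℂ) =
      -(Real.eulerMascheroniConstant : ℂ) := by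
  have h1 := Complex.hasDerivAt_GammaIntegral (s := 1) (by simp)
  have h2 : HasDerivAt Complex.GammaIntegral (-(Real.eulerMascheroniConstant : ℂ)) 1 := by
    refine Complex.hasDerivAt_Gamma_one.congr_of_eventuallyEq ?_
    filter_upwards [(isOpen_lt continuous_const Complex.continuous_re).mem_nhds
      (show (0 : ℝ) < (1 : ℂ).re by simp)] with s hs
    exact (Complex.Gamma_eq_integral hs).symm
  rw [← h1.unique h2]
  simp

theorem integrableOn_log_mul_exp_neg :
    IntegrableOn (fun t : ℝ => ((Real.log t * Real.exp (-t) : ℝ) : ℂ)) (Set.Ioi 0) := by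
  -- A non-integrable function has Bochner integral 0, whereas the integral is -γ with γ > 1/2.
  by_contra h
  have h1 := integral_log_mul_exp_neg
  rw [integral_undef h] at h1
  have h2 := Real.one_half_lt_eulerMascheroniConstant
  have h3 : Real.eulerMascheroniConstant = 0 := by
    have := neg_eq_zero.1 h1.symm
    exact_mod_cast this
  linarith

/-- At 0 the bound 0 ≤ 1 - e⁻ᵗ ≤ t compares the function with t log t, which tends to 0; the default
`Real.log 0 = 0` gives the matching value. -/
theorem continuousOn_one_sub_exp_neg_mul_log :
    ContinuousOn (fun t : ℝ => (1 - Real.exp (-t)) * Real.log t) (Set.Ici 0) := by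
  intro t ht
  rcases eq_or_lt_of_le (show (0 : ℝ) ≤ t from ht) with rfl | ht
  · have h0 : Tendsto (fun t : ℝ => |t * Real.log t|) (𝓝[Set.Ici 0] 0) (𝓝 0) := by
      have := (Real.continuous_mul_log.abs.tendsto 0).mono_left
        (nhdsWithin_le_nhds (s := Set.Ici (0 : ℝ)))
      simpa using this
    rw [ContinuousWithinAt]
    simp only [Real.log_zero, mul_zero]
    refine squeeze_zero_norm' ?_ h0
    filter_upwards [self_mem_nhdsWithin] with s hs
    have hs0 : (0 : ℝ) ≤ s := hs
    rw [Real.norm_eq_abs, abs_mul, abs_mul]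
    refine mul_le_mul_of_nonneg_right ?_ (abs_nonneg _)
    rw [abs_of_nonneg hs0, abs_of_nonneg (by simpa using hs0)]
    linarith [Real.add_one_le_exp (-s)]
  · exact (ContinuousAt.mul (by fun_prop)
      (Real.continuousAt_log ht.ne')).continuousWithinAt

/-- Integration by parts with the primitive 1 - e⁻ᵗ of e⁻ᵗ, chosen to vanish at 0 and so to kill the
logarithm there. -/
theorem integral_log_mul_exp_neg_eq {x : ℝ} (hx : 0 ≤ x) :
    ∫ t in (0 : ℝ)..x, ((Real.log t * Real.exp (-t) : ℝ) : ℂ) =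
      (((1 - Real.exp (-x)) * Real.log x : ℝ) : ℂ) - Ein x := by
  have h := intervalIntegral.integral_eq_sub_of_hasDerivAt_of_le hx
    (f := fun t : ℝ => (((1 - Real.exp (-t)) * Real.log t : ℝ) : ℂ) - Ein t)
    (f' := fun t : ℝ => ((Real.log t * Real.exp (-t) : ℝ) : ℂ)) ?_ ?_ ?_
  · rw [h]
    simp [Ein]
  · refine ContinuousOn.sub ?_ ?_
    · exact Complex.continuous_ofReal.comp_continuousOn
        (continuousOn_one_sub_exp_neg_mul_log.mono Set.Icc_subset_Ici_self)
    · exact (differentiable_Ein.continuous.comp Complex.continuous_ofReal).continuousOn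
  · intro t ht
    have ht0 : (t : ℂ) ≠ 0 := by exact_mod_cast ht.1.ne'
    have h1 : HasDerivAt (fun t : ℝ => (1 - Real.exp (-t)) * Real.log t)
        (Real.exp (-t) * Real.log t + (1 - Real.exp (-t)) * t⁻¹) t := by
      have h2 : HasDerivAt (fun t : ℝ => 1 - Real.exp (-t)) (Real.exp (-t)) t := by
        simpa using ((hasDerivAt_neg t).exp).const_sub 1
      exact h2.mul (Real.hasDerivAt_log ht.1.ne')
    refine (h1.ofReal_comp.sub (hasDerivAt_Ein ht0).comp_ofReal).congr_deriv ?_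
    push_cast
    field_simp
    ring
  · rw [intervalIntegrable_iff_integrableOn_Ioc_of_le hx]
    exact integrableOn_log_mul_exp_neg.mono_set Set.Ioc_subset_Ioi_self

theorem tendsto_Ein_sub_log :
    Tendsto (fun x : ℝ => Ein x - Complex.log x) atTop
      (𝓝 (Real.eulerMascheroniConstant : ℂ)) := by
  have h1 := intervalIntegral_tendsto_integral_Ioi 0 integrableOn_log_mul_exp_neg tendsto_id
  rw [integral_log_mul_exp_neg] at h1
  have h2 : Tendsto (fun x : ℝ => ((Real.exp (-x) * Real.log x : ℝ) : ℂ)) atTop (𝓝 0) := by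
    have h3 : Tendsto (fun x : ℝ => Real.exp (-x) * Real.log x) atTop (𝓝 0) := by
      refine squeeze_zero_norm' ?_ (Real.tendsto_pow_mul_exp_neg_atTop_nhds_zero 1)
      filter_upwards [eventually_ge_atTop 1] with x hx
      rw [Real.norm_of_nonneg (mul_nonneg (Real.exp_pos _).le (Real.log_nonneg hx)), mul_comm,
        pow_one]
      gcongr
      linarith [Real.log_le_sub_one_of_pos (show 0 < x by linarith)]
    exact_mod_cast (Complex.continuous_ofReal.tendsto 0).comp h3
  have h4 := (h1.add h2).neg
  simp only [add_zero, neg_neg] at h4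
  refine h4.congr' ?_
  filter_upwards [eventually_ge_atTop 0] with x hx
  rw [id, integral_log_mul_exp_neg_eq hx, ← Complex.ofReal_log hx]
  push_cast
  ring

theorem segment_mem_slitPlane {c : ℂ} (hc : c.im ≠ 0) (s : ℝ) :
    1 + (s : ℂ) * (c - 1) ∈ Complex.slitPlane := by
  rw [Complex.mem_slitPlane_iff]
  by_cases hs : s = 0
  · left
    simp [hs]
  · right
    simpa [hs] using hc

/-- Ein - log has derivative -e⁻ʷ/w; it is integrated along the segment from R to Rc, which avoids
the cut of the logarithm. -/
theorem Ein_sub_log_sub {c : ℂ} (hc : c.im ≠ 0) {R : ℝ} (hR : 0 < R) :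
    (Ein (R * c) - Complex.log (R * c)) - (Ein R - Complex.log R) =
      ∫ s in (0 : ℝ)..1, -(c - 1) * Complex.exp (-(R * (1 + (s : ℂ) * (c - 1)))) /
        (1 + (s : ℂ) * (c - 1)) := by
  have hR0 : (R : ℂ) ≠ 0 := by exact_mod_cast hR.ne'
  have h := intervalIntegral.integral_eq_sub_of_hasDerivAt (a := 0) (b := 1)
    (f := fun s : ℝ => Ein (R * (1 + (s : ℂ) * (c - 1))) -
      Complex.log (R * (1 + (s : ℂ) * (c - 1))))
    (f' := fun s : ℝ => -(c - 1) * Complex.exp (-(R * (1 + (s : ℂ) * (c - 1)))) /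
        (1 + (s : ℂ) * (c - 1))) ?_ ?_
  · rw [h]
    simp
  · intro s _
    have hs := segment_mem_slitPlane hc s
    have hs0 := Complex.slitPlane_ne_zero hs
    have hsR : (R : ℂ) * (1 + (s : ℂ) * (c - 1)) ∈ Complex.slitPlane := by
      rw [Complex.mem_slitPlane_iff] at hs ⊢
      simp only [Complex.re_ofReal_mul, Complex.im_ofReal_mul]
      rcases hs with hs | hs
      · exact Or.inl (by positivity)
      · exact Or.inr (mul_ne_zero hR.ne' hs)
    have h1 : HasDerivAt (fun s : ℂ => (R : ℂ) * (1 + s * (c - 1))) (R * (c - 1)) (s : ℂ) := by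
      simpa using (((hasDerivAt_id (s : ℂ)).mul_const (c - 1)).const_add 1).const_mul (R : ℂ)
    have h2 := ((hasDerivAt_Ein (Complex.slitPlane_ne_zero hsR)).comp (s : ℂ) h1).sub
      (h1.clog hsR)
    refine h2.comp_ofReal.congr_deriv ?_
    field_simp
    ring
  · refine Continuous.intervalIntegrable ?_ 0 1
    refine Continuous.div (by fun_prop) (by fun_prop) fun s => ?_
    exact Complex.slitPlane_ne_zero (segment_mem_slitPlane hc s)

/-- On the segment the real part 1 - s + s Re c is nonnegative, and positive for s < 1. The
exponential is therefore at most 1 and decays for almost every s, which suffices for dominated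
convergence even when c = ±i. -/
theorem tendsto_Ein_sub_log_mul {c : ℂ} (hc : c.im ≠ 0) (hc0 : 0 ≤ c.re) :
    Tendsto (fun R : ℝ => Ein (R * c) - Complex.log (R * c)) atTop
      (𝓝 (Real.eulerMascheroniConstant : ℂ)) := by
  have hne : ∀ s : ℝ, 1 + (s : ℂ) * (c - 1) ≠ 0 := fun s =>
    Complex.slitPlane_ne_zero (segment_mem_slitPlane hc s)
  have hre : ∀ R s : ℝ, ‖Complex.exp (-(R * (1 + (s : ℂ) * (c - 1))))‖ =
      Real.exp (-R * (1 + s * (c.re - 1))) := fun R s => by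
    rw [Complex.norm_exp]
    congr 1
    simp
  have hlim : Tendsto (fun R : ℝ => ∫ s in (0 : ℝ)..1, -(c - 1) *
      Complex.exp (-(R * (1 + (s : ℂ) * (c - 1)))) / (1 + (s : ℂ) * (c - 1))) atTop
      (𝓝 (∫ _ in (0 : ℝ)..1, (0 : ℂ))) := by
    refine intervalIntegral.tendsto_integral_filter_of_dominated_convergence
      (fun s : ℝ => ‖-(c - 1)‖ * 1 / ‖1 + (s : ℂ) * (c - 1)‖) ?_ ?_ ?_ ?_
    · refine Eventually.of_forall fun R => Continuous.aestronglyMeasurable ?_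
      exact Continuous.div (by fun_prop) (by fun_prop) hne
    · filter_upwards [eventually_ge_atTop 0] with R hR
      refine Eventually.of_forall fun s hs => ?_
      rw [Set.uIoc_of_le zero_le_one] at hs
      rw [norm_div, norm_mul, hre]
      gcongr
      rw [Real.exp_le_one_iff]
      have : 0 ≤ R * (1 + s * (c.re - 1)) := mul_nonneg hR (by nlinarith [hs.1, hs.2])
      linarith
    · refine Continuous.intervalIntegrable ?_ 0 1
      exact Continuous.div (by fun_prop) (by fun_prop) fun s => norm_ne_zero_iff.2 (hne s)
    · filter_upwards [compl_mem_ae_iff.2 (measure_singleton (1 : ℝ))] with s hs1 hs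
      rw [Set.uIoc_of_le zero_le_one] at hs
      have hs1' : s < 1 := lt_of_le_of_ne hs.2 hs1
      have h0 : 0 < 1 + s * (c.re - 1) := by nlinarith [hs.1, mul_nonneg hs.1.le hc0]
      have h2 : Tendsto (fun R : ℝ => Complex.exp (-(R * (1 + (s : ℂ) * (c - 1))))) atTop
          (𝓝 0) := by
        rw [tendsto_zero_iff_norm_tendsto_zero]
        simp_rw [hre]
        refine Real.tendsto_exp_atBot.comp ?_
        exact Tendsto.atBot_mul_const h0 tendsto_neg_atTop_atBot
      simpa using (h2.const_mul (-(c - 1))).div_const (1 + (s : ℂ) * (c - 1))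
  simp only [intervalIntegral.integral_zero] at hlim
  have h := hlim.add tendsto_Ein_sub_log
  rw [zero_add] at h
  refine h.congr' ?_
  filter_upwards [eventually_gt_atTop 0] with R hR
  rw [← Ein_sub_log_sub hc hR]
  ring

/-- Take c = i: the summand iπ/2 of log(iR) is what turns `Si` into `si`. With c = -i, the conjugate
combination follows, and the two together separate `Ci` from `si`. -/
theorem tendsto_neg_Ci_add_si :
    Tendsto (fun R : ℝ => -Ci R + Complex.I * si R) atTop (𝓝 0) := by
  have h := (tendsto_Ein_sub_log_mul (c := Complex.I) (by simp) (by simp)).sub_const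
    (Real.eulerMascheroniConstant : ℂ)
  rw [sub_self] at h
  refine h.congr' ?_
  filter_upwards [eventually_gt_atTop 0] with R hR
  rw [Ein_mul_I, Complex.log_ofReal_mul hR Complex.I_ne_zero, Complex.log_I, Ci, si,
    Complex.ofReal_log hR.le]
  ring

theorem tendsto_neg_Ci_sub_si :
    Tendsto (fun R : ℝ => -Ci R - Complex.I * si R) atTop (𝓝 0) := by
  have h := (tendsto_Ein_sub_log_mul (c := -Complex.I) (by simp) (by simp)).sub_const
    (Real.eulerMascheroniConstant : ℂ)
  rw [sub_self] at h
  refine h.congr' ?_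
  filter_upwards [eventually_gt_atTop 0] with R hR
  have h1 : (R : ℂ) * -Complex.I = -R * Complex.I := by ring
  rw [Complex.log_ofReal_mul hR (neg_ne_zero.2 Complex.I_ne_zero), Complex.log_neg_I, h1,
    Ein_mul_I, Cin_neg, Si_neg, Ci, si, Complex.ofReal_log hR.le]
  ring

theorem tendsto_Ci_ofReal : Tendsto (fun R : ℝ => Ci R) atTop (𝓝 0) := by
  have h := (tendsto_neg_Ci_add_si.add tendsto_neg_Ci_sub_si).const_mul (-1 / 2 : ℂ)
  simp only [add_zero, mul_zero] at h
  exact h.congr fun R => by ring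

theorem tendsto_si_ofReal : Tendsto (fun R : ℝ => si R) atTop (𝓝 0) := by
  have h := (tendsto_neg_Ci_add_si.sub tendsto_neg_Ci_sub_si).const_mul (-Complex.I / 2 : ℂ)
  simp only [sub_zero, mul_zero] at h
  refine h.congr fun R => ?_
  linear_combination (-si R) * Complex.I_sq

theorem norm_sin_le (w : ℂ) : ‖Complex.sin w‖ ≤ Real.exp |w.im| := by
  have h1 : ‖Complex.exp (-w * Complex.I)‖ ≤ Real.exp |w.im| := by
    rw [Complex.norm_exp]
    simpa using le_abs_self w.im
  have h2 : ‖Complex.exp (w * Complex.I)‖ ≤ Real.exp |w.im| := by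
    rw [Complex.norm_exp]
    simpa using neg_le_abs w.im
  rw [Complex.sin, norm_div, norm_mul, Complex.norm_I, Complex.norm_two]
  linarith [norm_sub_le (Complex.exp (-w * Complex.I)) (Complex.exp (w * Complex.I))]

theorem norm_cos_le (w : ℂ) : ‖Complex.cos w‖ ≤ Real.exp |w.im| := by
  have h1 : ‖Complex.exp (-w * Complex.I)‖ ≤ Real.exp |w.im| := by
    rw [Complex.norm_exp]
    simpa using le_abs_self w.im
  have h2 : ‖Complex.exp (w * Complex.I)‖ ≤ Real.exp |w.im| := by
    rw [Complex.norm_exp]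
    simpa using neg_le_abs w.im
  rw [Complex.cos, norm_div, Complex.norm_two]
  linarith [norm_add_le (Complex.exp (w * Complex.I)) (Complex.exp (-w * Complex.I))]

/-- Mean value inequality on the ball of radius ‖z‖ about R: there |Im w| ≤ ‖z‖ and |w| ≥ R - ‖z‖,
so the derivative is O(1/R). -/
theorem tendsto_add_ofReal_of_hasDerivAt {G g : ℂ → ℂ}
    (hG : ∀ w : ℂ, 0 < w.re → HasDerivAt G (g w / w) w)
    (hg : ∀ w : ℂ, ‖g w‖ ≤ Real.exp |w.im|)
    (h : Tendsto (fun R : ℝ => G R) atTop (𝓝 0)) (z : ℂ) :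
    Tendsto (fun R : ℝ => G (z + R)) atTop (𝓝 0) := by
  have h1 : Tendsto (fun R : ℝ => G (z + R) - G R) atTop (𝓝 0) := by
    have h2 : Tendsto (fun R : ℝ => Real.exp ‖z‖ / (R - ‖z‖) * ‖z‖) atTop (𝓝 0) := by
      have h3 : Tendsto (fun R : ℝ => R - ‖z‖) atTop atTop :=
        tendsto_atTop_add_const_right _ _ tendsto_id
      simpa using (h3.const_div_atTop (Real.exp ‖z‖)).mul_const ‖z‖
    refine squeeze_zero_norm' ?_ h2
    filter_upwards [eventually_gt_atTop ‖z‖] with R hR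
    have hball : ∀ w ∈ Metric.closedBall (R : ℂ) ‖z‖, |w.im| ≤ ‖z‖ ∧ R - ‖z‖ ≤ w.re := by
      intro w hw
      have hw' : ‖w - R‖ ≤ ‖z‖ := by simpa [dist_eq_norm] using Metric.mem_closedBall.1 hw
      have h4 := (Complex.abs_im_le_norm (w - R)).trans hw'
      have h5 := (abs_le.1 ((Complex.abs_re_le_norm (w - R)).trans hw')).1
      simp only [Complex.sub_im, Complex.ofReal_im, sub_zero, Complex.sub_re,
        Complex.ofReal_re] at h4 h5
      exact ⟨h4, by linarith⟩
    have h6 := Convex.norm_image_sub_le_of_norm_hasDerivWithin_le (f := G)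
      (f' := fun w => g w / w) (s := Metric.closedBall (R : ℂ) ‖z‖) (x := (R : ℂ)) (y := z + R)
      (C := Real.exp ‖z‖ / (R - ‖z‖)) (fun w hw => (hG w (by
        linarith [(hball w hw).2])).hasDerivWithinAt) (fun w hw => by
        obtain ⟨h7, h8⟩ := hball w hw
        rw [norm_div]
        exact div_le_div₀ (Real.exp_pos _).le ((hg w).trans (Real.exp_le_exp.2 h7))
          (by linarith) (h8.trans ((le_abs_self _).trans (Complex.abs_re_le_norm w))))
      (convex_closedBall _ _) (by simp) (by simp)
    simpa using h6
  simpa using h1.add h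

theorem add_ofReal_mem_slitPlane {z : ℂ} (hz : z ∈ Complex.slitPlane) {t : ℝ} (ht : 0 ≤ t) :
    z + t ∈ Complex.slitPlane := by
  rw [Complex.mem_slitPlane_iff] at hz ⊢
  rcases hz with hz | hz
  · left
    simp
    linarith
  · right
    simpa using hz

/-- Writing sin t = sin((z + t) - z) and expanding yields the primitive cos z si(z+t) - sin z
Ci(z+t), whose value at t = 0 is -f(z). -/
theorem integral_sin_div_add {z : ℂ} (hz : z ∈ Complex.slitPlane) {R : ℝ} (hR : 0 ≤ R) :
    ∫ t in (0 : ℝ)..R, (Real.sin t : ℂ) / (t + z) =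
      auxF z + (Complex.cos z * si (z + R) - Complex.sin z * Ci (z + R)) := by
  have hmem : ∀ t ∈ Set.uIcc 0 R, z + (t : ℂ) ∈ Complex.slitPlane := fun t ht => by
    rw [Set.uIcc_of_le hR] at ht
    exact add_ofReal_mem_slitPlane hz ht.1
  have h := intervalIntegral.integral_eq_sub_of_hasDerivAt (a := 0) (b := R)
    (f := fun t : ℝ => Complex.cos z * si (z + t) - Complex.sin z * Ci (z + t))
    (f' := fun t : ℝ => (Real.sin t : ℂ) / (t + z)) ?_ ?_
  · rw [h, auxF]
    simp
    ring
  · intro t ht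
    have h1 : HasDerivAt (fun t : ℂ => z + t) 1 (t : ℂ) := (hasDerivAt_id (t : ℂ)).const_add z
    have h0 := Complex.slitPlane_ne_zero (hmem t ht)
    have h2 := (((hasDerivAt_si h0).comp (t : ℂ) h1).const_mul (Complex.cos z)).sub
      (((hasDerivAt_Ci (hmem t ht)).comp (t : ℂ) h1).const_mul (Complex.sin z))
    refine h2.comp_ofReal.congr_deriv ?_
    have h3 : (Real.sin t : ℂ) = Complex.sin ((z + t) - z) := by simp
    rw [h3, Complex.sin_sub, add_comm (t : ℂ) z]
    field_simp
  · refine ContinuousOn.intervalIntegrable ?_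
    refine ContinuousOn.div (by fun_prop) (by fun_prop) fun t ht => ?_
    rw [add_comm]
    exact Complex.slitPlane_ne_zero (hmem t ht)

theorem tendsto_integral_sin_div_add {z : ℂ} (hz : z ∈ Complex.slitPlane) :
    Tendsto (fun R : ℝ => ∫ t in (0 : ℝ)..R, (Real.sin t : ℂ) / (t + z)) atTop
      (𝓝 (auxF z)) := by
  have h1 := tendsto_add_ofReal_of_hasDerivAt (G := si)
    (fun w hw => hasDerivAt_si (by rintro rfl; simp at hw)) norm_sin_le tendsto_si_ofReal z
  have h2 := tendsto_add_ofReal_of_hasDerivAt (G := Ci)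
    (fun w hw => hasDerivAt_Ci (Complex.mem_slitPlane_iff.2 (Or.inl hw)))
    norm_cos_le tendsto_Ci_ofReal z
  have h3 := ((h1.const_mul (Complex.cos z)).sub (h2.const_mul (Complex.sin z))).const_add (auxF z)
  simp only [mul_zero, sub_zero, add_zero] at h3
  refine h3.congr' ?_
  filter_upwards [eventually_ge_atTop 0] with R hR
  exact (integral_sin_div_add hz hR).symm

/-! ### Fourier transforms as limits of truncated integrals -/

/-- The truncated Fourier integral `∫_{-R}^R g(t) e^{-2πiνt} dt`. -/
noncomputable def truncFourier (g : ℝ → ℂ) (R ν : ℝ) : ℂ :=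
  ∫ t in (-R)..R, g t * Complex.exp (-Complex.I * 2 * (Real.pi : ℂ) * (ν : ℂ) * (t : ℂ))

theorem truncFourier_eq_fourier (g : ℝ → ℂ) {R : ℝ} (hR : 0 ≤ R) :
    truncFourier g R = 𝓕 ((Set.Ioc (-R) R).indicator g) := by
  ext ν
  rw [truncFourier, intervalIntegral.integral_of_le (by linarith),
    ← integral_indicator measurableSet_Ioc, Real.fourier_real_eq_integral_exp_smul]
  congr 1
  ext t
  by_cases ht : t ∈ Set.Ioc (-R) R
  · rw [Set.indicator_of_mem ht, Set.indicator_of_mem ht, smul_eq_mul, mul_comm]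
    congr 2
    push_cast
    ring
  · rw [Set.indicator_of_notMem ht, Set.indicator_of_notMem ht, smul_zero]

theorem integral_fourier_mul_eq {f g : ℝ → ℂ} (hf : Integrable f) (hg : Integrable g) :
    ∫ x, 𝓕 f x * g x = ∫ x, f x * 𝓕 g x := by
  have h := VectorFourier.integral_fourierIntegral_smul_eq_flip (L := innerₗ ℝ)
    (e := Real.fourierChar) (μ := volume) (ν := volume) Real.continuous_fourierChar
    continuous_inner hf hg
  simpa using! h

theorem IsTempered.integrableOn_Ioc {g : ℝ → ℂ} (hg : IsTempered g) (R : ℝ) :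
    IntegrableOn g (Set.Ioc (-R) R) := by
  have hmeas := hg.aestronglyMeasurable
  obtain ⟨m, hm⟩ := hg
  refine Integrable.mono' (hm.norm.const_mul ((1 + R) ^ m)).integrableOn hmeas.restrict ?_
  filter_upwards [ae_restrict_mem measurableSet_Ioc] with x hx
  have h1 : |x| ≤ R := abs_le.2 ⟨hx.1.le, hx.2⟩
  have h2 : (1 + |x|) ^ m ≤ (1 + R) ^ m := by gcongr
  have h3 : 0 < (1 + |x|) ^ m := by positivity
  rw [norm_weight_mul, ← mul_assoc]
  refine le_mul_of_one_le_left (norm_nonneg _) ?_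
  rw [← div_eq_mul_inv, one_le_div h3]
  exact h2

/-- The transform is moved from the truncation of g to φ, after which the integrands are dominated
by |𝓕φ · g|. -/
theorem tendsto_integral_mul_truncFourier {g : ℝ → ℂ} (hg : IsTempered g) (φ : 𝓢(ℝ, ℂ)) :
    Tendsto (fun n : ℕ => ∫ ν, φ ν * truncFourier g n ν) atTop (𝓝 (𝓕 (dist g) φ)) := by
  have h1 : ∀ n : ℕ, ∫ ν, φ ν * truncFourier g n ν =
      ∫ x, (Set.Ioc (-(n : ℝ)) n).indicator (fun x => 𝓕 φ x * g x) x := fun n => by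
    rw [truncFourier_eq_fourier g n.cast_nonneg, ← integral_fourier_mul_eq φ.integrable
      ((integrable_indicator_iff measurableSet_Ioc).2 (hg.integrableOn_Ioc n))]
    congr 1
    ext x
    by_cases hx : x ∈ Set.Ioc (-(n : ℝ)) n
    · simp [hx, SchwartzMap.fourier_coe]
    · simp [hx]
  simp_rw [h1]
  rw [TemperedDistribution.fourier_apply, dist_apply hg]
  have hInt := hg.integrable_mul (𝓕 φ)
  refine tendsto_integral_of_dominated_convergence (fun x => ‖𝓕 φ x * g x‖)
    (fun n => hInt.aestronglyMeasurable.indicator measurableSet_Ioc) hInt.norm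
    (fun n => Eventually.of_forall fun x => norm_indicator_le_norm_self _ _)
    (Eventually.of_forall fun x => ?_)
  refine tendsto_const_nhds.congr' ?_
  filter_upwards [eventually_gt_atTop ⌈|x|⌉₊] with n hn
  have h2 : |x| < n := (Nat.le_ceil _).trans_lt (by exact_mod_cast hn)
  rw [Set.indicator_of_mem]
  exact ⟨(abs_lt.1 h2).1, (abs_lt.1 h2).2.le⟩

theorem continuous_truncFourier {g : ℝ → ℂ} (hg : IsTempered g) {R : ℝ} (hR : 0 ≤ R) :
    Continuous (truncFourier g R) := by
  rw [truncFourier_eq_fourier g hR]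
  exact VectorFourier.fourierIntegral_continuous Real.continuous_fourierChar
    continuous_inner ((integrable_indicator_iff measurableSet_Ioc).2 (hg.integrableOn_Ioc R))

/-- The pairings of the truncated transforms with φ have two limits: the distributional transform,
and, by dominated convergence with bound C‖φ‖, the integral of φ h. -/
theorem fourier_dist_of_tendsto_truncFourier {g h : ℝ → ℂ} (hg : IsTempered g) (C : ℝ)
    (hbound : ∀ R ν, 0 ≤ R → ‖truncFourier g R ν‖ ≤ C)
    (hlim : ∀ ν, Tendsto (fun R => truncFourier g R ν) atTop (𝓝 (h ν))) :
    IsTempered h ∧ 𝓕 (dist g) = dist h := by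
  have hlim' : ∀ ν, Tendsto (fun n : ℕ => truncFourier g n ν) atTop (𝓝 (h ν)) := fun ν =>
    (hlim ν).comp tendsto_natCast_atTop_atTop
  have hh : IsTempered h := by
    refine IsTempered.of_norm_le (aestronglyMeasurable_of_tendsto_ae atTop
      (f := fun n : ℕ => truncFourier g n)
      (fun n => (continuous_truncFourier hg n.cast_nonneg).aestronglyMeasurable)
      (Eventually.of_forall hlim')) 0 C fun ν => ?_
    rw [pow_zero, mul_one]
    exact le_of_tendsto (hlim' ν).norm (Eventually.of_forall fun n => hbound n ν n.cast_nonneg)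
  refine ⟨hh, ?_⟩
  ext φ
  refine tendsto_nhds_unique (tendsto_integral_mul_truncFourier hg φ) ?_
  rw [dist_apply hh]
  refine tendsto_integral_of_dominated_convergence (fun x => ‖φ x‖ * C) (fun n => ?_)
    (φ.integrable.norm.mul_const C) (fun n => Eventually.of_forall fun ν => ?_)
    (Eventually.of_forall fun ν => (hlim' ν).const_mul _)
  · exact (φ.continuous.mul (continuous_truncFourier hg n.cast_nonneg)).aestronglyMeasurable
  · rw [norm_mul]
    gcongr
    exact hbound n ν n.cast_nonneg

/-! ### Odd extensions -/

theorem oddExt_of_pos (g : ℝ → ℂ) {x : ℝ} (hx : 0 < x) : oddExt g x = g x := by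
  rw [oddExt, if_pos hx]

theorem oddExt_neg (g : ℝ → ℂ) (x : ℝ) : oddExt g (-x) = -oddExt g x := by
  rcases lt_trichotomy x 0 with hx | rfl | hx
  · simp [oddExt, hx, hx.ne, not_lt.2 hx.le]
  · simp [oddExt]
  · simp [oddExt, hx, hx.ne', not_lt.2 hx.le]

theorem oddExt_zero (g : ℝ → ℂ) : oddExt g 0 = 0 := by simp [oddExt]

theorem oddExt_eq_sign_mul (g : ℝ → ℂ) (x : ℝ) :
    oddExt g x = (Real.sign x : ℂ) * g |x| := by
  rcases lt_trichotomy x 0 with hx | rfl | hx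
  · simp [oddExt, hx.ne, not_lt.2 hx.le, Real.sign_of_neg hx, abs_of_neg hx]
  · simp [oddExt]
  · simp [oddExt, hx, Real.sign_of_pos hx, abs_of_pos hx]

theorem measurable_sign : Measurable fun x : ℝ => (Real.sign x : ℂ) := by
  refine Complex.measurable_ofReal.comp ?_
  unfold Real.sign
  exact Measurable.ite measurableSet_Iio measurable_const
    (Measurable.ite measurableSet_Ioi measurable_const measurable_const)

theorem norm_oddExt_le (g : ℝ → ℂ) (x : ℝ) : ‖oddExt g x‖ ≤ ‖g |x|‖ := by
  rw [oddExt_eq_sign_mul, norm_mul, Complex.norm_real]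
  refine mul_le_of_le_one_left (norm_nonneg _) ?_
  rcases Real.sign_apply_eq x with h | h | h <;> simp [h]

theorem truncFourier_oddExt {g : ℝ → ℂ} {R : ℝ} (hR : 0 ≤ R)
    (hg : IntervalIntegrable g volume 0 R) (ν : ℝ) :
    truncFourier (oddExt g) R ν =
      -2 * Complex.I * ∫ t in (0 : ℝ)..R, (Real.sin (2 * Real.pi * ν * t) : ℂ) * g t := by
  set e : ℝ → ℂ := fun t =>
    Complex.exp (-Complex.I * 2 * (Real.pi : ℂ) * (ν : ℂ) * (t : ℂ)) with he
  have hec : Continuous e := by fun_prop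
  have h1 : IntervalIntegrable (oddExt g) volume 0 R := by
    refine hg.congr fun t ht => ?_
    rw [Set.uIoc_of_le hR] at ht
    exact (oddExt_of_pos g ht.1).symm
  have h2 : IntervalIntegrable (fun t => oddExt g t * e t) volume 0 R :=
    h1.mul_continuousOn hec.continuousOn
  have h3 : IntervalIntegrable (fun t => oddExt g (-t) * e (-t)) volume 0 R := by
    simp_rw [oddExt_neg]
    exact h1.neg.mul_continuousOn (hec.comp continuous_neg).continuousOn
  have h4 : IntervalIntegrable (fun t => oddExt g t * e t) volume (-R) 0 := by
    have := (IntervalIntegrable.iff_comp_neg enorm_ne_top).1 h3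
    simpa using this.symm
  have h5 : ∫ t in (-R)..0, oddExt g t * e t = ∫ t in (0 : ℝ)..R, oddExt g (-t) * e (-t) := by
    rw [intervalIntegral.integral_comp_neg (fun t => oddExt g t * e t)]
    simp
  rw [truncFourier, ← intervalIntegral.integral_add_adjacent_intervals h4 h2, h5,
    ← intervalIntegral.integral_add h3 h2, ← intervalIntegral.integral_const_mul]
  refine intervalIntegral.integral_congr_ae (Eventually.of_forall fun t ht => ?_)
  rw [Set.uIoc_of_le hR] at ht
  rw [oddExt_neg, oddExt_of_pos g ht.1]
  have h6 : e t = Complex.exp (-((2 * Real.pi * ν * t : ℝ) : ℂ) * Complex.I) := by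
    simp only [he]
    congr 1
    push_cast
    ring
  have h7 : e (-t) = Complex.exp (((2 * Real.pi * ν * t : ℝ) : ℂ) * Complex.I) := by
    simp only [he]
    congr 1
    push_cast
    ring
  rw [h6, h7, Complex.ofReal_sin, Complex.sin]
  linear_combination (g t * (Complex.exp (-((2 * Real.pi * ν * t : ℝ) : ℂ) * Complex.I) -
    Complex.exp (((2 * Real.pi * ν * t : ℝ) : ℂ) * Complex.I))) * Complex.I_sq

/-! ### Resonances -/

/-- For t ≥ 2‖z‖ + 1 the triangle inequality gives (1 + t)/2; for smaller t, 1 + t is bounded and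
the distance from -z to the half-line is positive. -/
theorem exists_mul_one_add_le_norm_add {z : ℂ} (hz : z ∈ Complex.slitPlane) :
    ∃ c : ℝ, 0 < c ∧ ∀ t : ℝ, 0 ≤ t → c * (1 + t) ≤ ‖(t : ℂ) + z‖ := by
  obtain ⟨d, hd, hdle⟩ : ∃ d : ℝ, 0 < d ∧ ∀ t : ℝ, 0 ≤ t → d ≤ ‖(t : ℂ) + z‖ := by
    rcases Complex.mem_slitPlane_iff.1 hz with h | h
    · refine ⟨z.re, h, fun t ht => ?_⟩
      have := (le_abs_self _).trans (Complex.abs_re_le_norm ((t : ℂ) + z))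
      simp only [Complex.add_re, Complex.ofReal_re] at this
      linarith
    · refine ⟨|z.im|, abs_pos.2 h, fun t _ => ?_⟩
      simpa using Complex.abs_im_le_norm ((t : ℂ) + z)
  have hpos : 0 < 2 * ‖z‖ + 2 := by positivity
  refine ⟨min (d / (2 * ‖z‖ + 2)) (1 / 2), by positivity, fun t ht => ?_⟩
  rcases le_total t (2 * ‖z‖ + 1) with h | h
  · calc min (d / (2 * ‖z‖ + 2)) (1 / 2) * (1 + t) ≤ d / (2 * ‖z‖ + 2) * (2 * ‖z‖ + 2) := by
          refine mul_le_mul (min_le_left _ _) (by linarith) (by linarith) (by positivity)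
      _ = d := by field_simp
      _ ≤ _ := hdle t ht
  · have h1 : t - ‖z‖ ≤ ‖(t : ℂ) + z‖ := by
      have := norm_sub_le ((t : ℂ) + z) z
      rw [add_sub_cancel_right, Complex.norm_real, Real.norm_of_nonneg ht] at this
      linarith
    calc min (d / (2 * ‖z‖ + 2)) (1 / 2) * (1 + t) ≤ 1 / 2 * (1 + t) := by
          gcongr
          exact min_le_right _ _
      _ ≤ _ := by linarith

theorem one_sub_cos_le_abs (x : ℝ) : 1 - Real.cos x ≤ |x| := by
  have h1 := Real.one_sub_sq_div_two_le_cos (x := x)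
  have h2 := Real.neg_one_le_cos x
  rcases le_total |x| 2 with h | h
  · nlinarith [abs_nonneg x, sq_abs x]
  · linarith

theorem one_sub_cos_le (x : ℝ) : 1 - Real.cos x ≤ 4 * x ^ 2 * (1 + x ^ 2)⁻¹ := by
  have h1 := Real.one_sub_sq_div_two_le_cos (x := x)
  have h2 := Real.neg_one_le_cos x
  rw [← div_eq_mul_inv, le_div_iff₀ (by positivity)]
  rcases le_total (x ^ 2) 1 with h | h <;> nlinarith [sq_nonneg x]

/-- Integration by parts with the primitive 1 - cos t, which vanishes to second order at 0. The
condition on c is invariant under replacing z by a positive multiple, so the bound will be uniform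
in the frequency. -/
theorem norm_integral_sin_div_add_le {z : ℂ} (hz : z ∈ Complex.slitPlane) {c : ℝ} (hc : 0 < c)
    (hcle : ∀ t : ℝ, 0 ≤ t → c * t ≤ ‖(t : ℂ) + z‖) {R : ℝ} (hR : 0 ≤ R) :
    ‖∫ t in (0 : ℝ)..R, (Real.sin t : ℂ) / (t + z)‖ ≤ c⁻¹ + 4 * (c ^ 2)⁻¹ * Real.pi := by
  have hne : ∀ t ∈ Set.uIcc 0 R, (t : ℂ) + z ≠ 0 := fun t ht => by
    rw [Set.uIcc_of_le hR] at ht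
    rw [add_comm]
    exact Complex.slitPlane_ne_zero (add_ofReal_mem_slitPlane hz ht.1)
  have hcont : ContinuousOn (fun t : ℝ => ((1 - Real.cos t : ℝ) : ℂ) / (t + z) ^ 2)
      (Set.uIcc 0 R) :=
    ContinuousOn.div (by fun_prop) (by fun_prop) fun t ht => pow_ne_zero 2 (hne t ht)
  have hparts : ∫ t in (0 : ℝ)..R, (Real.sin t : ℂ) / (t + z) =
      ((1 - Real.cos R : ℝ) : ℂ) / (R + z) +
        ∫ t in (0 : ℝ)..R, ((1 - Real.cos t : ℝ) : ℂ) / (t + z) ^ 2 := by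
    have hs : IntervalIntegrable (fun t : ℝ => (Real.sin t : ℂ) / (t + z)) volume 0 R :=
      (ContinuousOn.div (by fun_prop) (by fun_prop) hne).intervalIntegrable
    have h := intervalIntegral.integral_eq_sub_of_hasDerivAt (a := 0) (b := R)
      (f := fun t : ℝ => ((1 - Real.cos t : ℝ) : ℂ) / (t + z))
      (f' := fun t : ℝ => (Real.sin t : ℂ) / (t + z) -
        ((1 - Real.cos t : ℝ) : ℂ) / (t + z) ^ 2) (fun t ht => ?_)
      (hs.sub hcont.intervalIntegrable)
    · rw [intervalIntegral.integral_sub hs hcont.intervalIntegrable] at h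
      rw [sub_eq_iff_eq_add.1 h]
      simp
    · have h1 : HasDerivAt (fun t : ℝ => ((1 - Real.cos t : ℝ) : ℂ)) (Real.sin t : ℂ) t := by
        have := ((Real.hasDerivAt_cos t).const_sub 1).ofReal_comp
        simpa using this
      have h2 : HasDerivAt (fun t : ℝ => (t : ℂ) + z) 1 t := by
        simpa using ((hasDerivAt_id t).ofReal_comp).add_const z
      refine (h1.div h2 (hne t ht)).congr_deriv ?_
      have := hne t ht
      field_simp
  have hnorm : ∀ t : ℝ, ‖((1 - Real.cos t : ℝ) : ℂ)‖ = 1 - Real.cos t := fun t => by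
    rw [Complex.norm_real, Real.norm_of_nonneg (by linarith [Real.cos_le_one t])]
  rw [hparts]
  refine (norm_add_le _ _).trans (add_le_add ?_ ?_)
  · rw [norm_div, hnorm]
    rcases eq_or_lt_of_le hR with rfl | hR0
    · simpa using hc.le
    · rw [inv_eq_one_div]
      calc (1 - Real.cos R) / ‖(R : ℂ) + z‖ ≤ R / (c * R) := by
            refine div_le_div₀ hR ?_ (by positivity) (hcle R hR)
            simpa [abs_of_nonneg hR] using one_sub_cos_le_abs R
        _ = 1 / c := by field_simp
  · have hb : ∀ t ∈ Set.Ioc 0 R, ‖((1 - Real.cos t : ℝ) : ℂ) / (t + z) ^ 2‖ ≤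
        4 * (c ^ 2)⁻¹ * (1 + t ^ 2)⁻¹ := fun t ht => by
      rw [norm_div, hnorm, norm_pow]
      calc (1 - Real.cos t) / ‖(t : ℂ) + z‖ ^ 2
          ≤ (4 * t ^ 2 * (1 + t ^ 2)⁻¹) / (c * t) ^ 2 := by
            have ht0 := ht.1
            refine div_le_div₀ (by positivity) (one_sub_cos_le t) (by positivity) ?_
            gcongr
            exact hcle t ht.1.le
        _ = 4 * (c ^ 2)⁻¹ * (1 + t ^ 2)⁻¹ := by
            have ht0 := ht.1.ne'
            field_simp
    refine (intervalIntegral.norm_integral_le_of_norm_le hR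
      (Eventually.of_forall fun t ht => hb t ht)
      (Continuous.intervalIntegrable ?_ 0 R)).trans ?_
    · exact continuous_const.mul (Continuous.inv₀ (by fun_prop) fun t => by positivity)
    · rw [intervalIntegral.integral_const_mul]
      gcongr
      rw [integral_inv_one_add_sq]
      simp only [Real.arctan_zero, sub_zero]
      linarith [Real.arctan_lt_pi_div_two R, Real.pi_pos]

theorem pos_mul_mem_slitPlane {z : ℂ} (hz : z ∈ Complex.slitPlane) {w : ℝ} (hw : 0 < w) :
    (w : ℂ) * z ∈ Complex.slitPlane := by
  rw [Complex.mem_slitPlane_iff] at hz ⊢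
  simp only [Complex.re_ofReal_mul, Complex.im_ofReal_mul]
  rcases hz with h | h
  · exact Or.inl (by positivity)
  · exact Or.inr (mul_ne_zero hw.ne' h)

theorem integral_sin_mul_div_eq (q : ℂ) {w : ℝ} (hw : 0 < w) (R : ℝ) :
    ∫ t in (0 : ℝ)..R, (Real.sin (w * t) : ℂ) * (1 / ((t : ℂ) - q)) =
      ∫ t in (0 : ℝ)..(w * R), (Real.sin t : ℂ) / (t + w * -q) := by
  have hw0 : (w : ℂ) ≠ 0 := by exact_mod_cast hw.ne'
  have h := intervalIntegral.smul_integral_comp_mul_left (a := 0) (b := R)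
    (fun t : ℝ => (Real.sin t : ℂ) / (t + w * -q)) w
  rw [mul_zero] at h
  rw [← h, ← intervalIntegral.integral_smul]
  congr 1
  ext t
  have h1 : ((w * t : ℝ) : ℂ) + w * -q = w * (t - q) := by push_cast; ring
  rw [h1, Complex.real_smul]
  -- At a pole on the line of integration both integrands are 0, division by zero being 0.
  by_cases h2 : (t : ℂ) - q = 0
  · simp [h2]
  · field_simp

theorem sub_ne_zero_of_neg_mem_slitPlane {q : ℂ} (hq : -q ∈ Complex.slitPlane) {t : ℝ}
    (ht : 0 ≤ t) : (t : ℂ) - q ≠ 0 := by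
  rw [sub_eq_neg_add]
  exact Complex.slitPlane_ne_zero (add_ofReal_mem_slitPlane hq ht)

theorem intervalIntegrable_inv_sub {q : ℂ} (hq : -q ∈ Complex.slitPlane) {R : ℝ} (hR : 0 ≤ R) :
    IntervalIntegrable (fun z : ℝ => 1 / ((z : ℂ) - q)) volume 0 R := by
  refine ContinuousOn.intervalIntegrable (ContinuousOn.div (by fun_prop) (by fun_prop) ?_)
  intro t ht
  rw [Set.uIcc_of_le hR] at ht
  exact sub_ne_zero_of_neg_mem_slitPlane hq ht.1

theorem truncFourier_resonance {q : ℂ} (hq : -q ∈ Complex.slitPlane) {R : ℝ} (hR : 0 ≤ R)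
    (ν : ℝ) :
    truncFourier (oddExt fun z => 1 / ((z : ℂ) - q)) R ν =
      -2 * Complex.I * (Real.sign ν : ℂ) *
        ∫ t in (0 : ℝ)..(2 * Real.pi * |ν| * R),
          (Real.sin t : ℂ) / (t + ((2 * Real.pi * |ν| : ℝ) : ℂ) * -q) := by
  rw [truncFourier_oddExt hR (intervalIntegrable_inv_sub hq hR)]
  rcases lt_trichotomy ν 0 with h | rfl | h
  · rw [← integral_sin_mul_div_eq q (by have := abs_pos.2 h.ne; positivity),
      Real.sign_of_neg h, abs_of_neg h]
    have h1 : ∀ t : ℝ, Real.sin (2 * Real.pi * ν * t) = -Real.sin (2 * Real.pi * -ν * t) :=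
      fun t => by rw [← Real.sin_neg]; congr 1; ring
    simp_rw [h1, Complex.ofReal_neg, neg_mul, intervalIntegral.integral_neg]
    push_cast
    ring
  · simp
  · rw [← integral_sin_mul_div_eq q (by have := abs_pos.2 h.ne'; positivity),
      Real.sign_of_pos h, abs_of_pos h]
    push_cast
    ring

theorem exists_norm_truncFourier_resonance_le {q : ℂ} (hq : -q ∈ Complex.slitPlane) :
    ∃ C : ℝ, ∀ R ν, 0 ≤ R →
      ‖truncFourier (oddExt fun z => 1 / ((z : ℂ) - q)) R ν‖ ≤ C := by
  obtain ⟨c, hc, hcle⟩ := exists_mul_one_add_le_norm_add hq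
  refine ⟨2 * (c⁻¹ + 4 * (c ^ 2)⁻¹ * Real.pi), fun R ν hR => ?_⟩
  rw [truncFourier_resonance hq hR]
  rcases eq_or_ne ν 0 with rfl | hν
  · simp
    positivity
  have hw : 0 < 2 * Real.pi * |ν| := by have := abs_pos.2 hν; positivity
  set w := 2 * Real.pi * |ν|
  have h1 := norm_integral_sin_div_add_le (pos_mul_mem_slitPlane hq hw) hc (fun t ht => ?_)
    (mul_nonneg hw.le hR)
  · have h2 : ‖-2 * Complex.I * (Real.sign ν : ℂ)‖ ≤ 2 := by
      rcases Real.sign_apply_eq ν with h | h | h <;> simp [h]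
    rw [norm_mul]
    gcongr
  -- The constant found for -q serves every w · (-q), by scaling t.
  · have h3 := hcle (t / w) (div_nonneg ht hw.le)
    have hw0 : (w : ℂ) ≠ 0 := by exact_mod_cast hw.ne'
    have h4 : (t : ℂ) + w * -q = w * (((t / w : ℝ) : ℂ) + -q) := by
      push_cast
      field_simp
    rw [h4, norm_mul, Complex.norm_real, Real.norm_of_nonneg hw.le]
    calc c * t = w * (c * (t / w)) := by field_simp
      _ ≤ w * (c * (1 + t / w)) := by gcongr; linarith
      _ ≤ _ := by gcongr

theorem tendsto_truncFourier_resonance {q : ℂ} (hq : -q ∈ Complex.slitPlane) (ν : ℝ) :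
    Tendsto (fun R => truncFourier (oddExt fun z => 1 / ((z : ℂ) - q)) R ν) atTop
      (𝓝 (Vhat q ν)) := by
  have h0 : Tendsto (fun R : ℝ => -2 * Complex.I * (Real.sign ν : ℂ) *
        ∫ t in (0 : ℝ)..(2 * Real.pi * |ν| * R),
          (Real.sin t : ℂ) / (t + ((2 * Real.pi * |ν| : ℝ) : ℂ) * -q)) atTop
      (𝓝 (Vhat q ν)) := by
    rcases eq_or_ne ν 0 with rfl | hν
    · simp [Vhat]
    have hw : 0 < 2 * Real.pi * |ν| := by have := abs_pos.2 hν; positivity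
    have h1 := (tendsto_integral_sin_div_add (pos_mul_mem_slitPlane hq hw)).comp
      (tendsto_id.const_mul_atTop hw)
    have h2 : Vhat q ν = -2 * Complex.I * (Real.sign ν : ℂ) *
        auxF (((2 * Real.pi * |ν| : ℝ) : ℂ) * -q) := by
      rw [Vhat]
      congr 2
      push_cast
      ring
    rw [h2]
    exact h1.const_mul _
  refine h0.congr' ?_
  filter_upwards [eventually_ge_atTop 0] with R hR
  exact (truncFourier_resonance hq hR ν).symm

theorem measurable_oddExt_resonance (q : ℂ) :
    Measurable (oddExt fun z => 1 / ((z : ℂ) - q)) := by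
  have h : oddExt (fun z => 1 / ((z : ℂ) - q)) = fun x : ℝ =>
      (Real.sign x : ℂ) * (1 / (((|x| : ℝ) : ℂ) - q)) := by
    ext x
    exact oddExt_eq_sign_mul _ x
  rw [h]
  exact measurable_sign.mul (by fun_prop)

theorem isTempered_oddExt_resonance {q : ℂ} (hq : -q ∈ Complex.slitPlane) :
    IsTempered (oddExt fun z => 1 / ((z : ℂ) - q)) := by
  obtain ⟨c, hc, hcle⟩ := exists_mul_one_add_le_norm_add hq
  refine IsTempered.of_norm_le (measurable_oddExt_resonance q).aestronglyMeasurable 0 c⁻¹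
    fun x => (norm_oddExt_le _ x).trans ?_
  have h1 := hcle |x| (abs_nonneg x)
  rw [norm_div, norm_one, pow_zero, mul_one, sub_eq_add_neg, one_div]
  refine inv_anti₀ hc (le_trans ?_ h1)
  nlinarith [abs_nonneg x]

theorem fourier_dist_resonance {q : ℂ} (hq : -q ∈ Complex.slitPlane) :
    IsTempered (Vhat q) ∧
      𝓕 (dist (oddExt fun z => 1 / ((z : ℂ) - q))) = dist (Vhat q) := by
  obtain ⟨C, hC⟩ := exists_norm_truncFourier_resonance_le hq
  exact fourier_dist_of_tendsto_truncFourier (isTempered_oddExt_resonance hq) C hC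
    (tendsto_truncFourier_resonance hq)

/-! ### Monomials -/

theorem integral_eq_integral_Ioi_add_neg {f : ℝ → ℂ} (hf : Integrable f) :
    ∫ x, f x = ∫ x in Set.Ioi (0 : ℝ), (f x + f (-x)) := by
  have h1 := integral_comp_neg_Ioi 0 f
  rw [neg_zero] at h1
  rw [integral_add hf.integrableOn hf.comp_neg.integrableOn, h1, add_comm,
    intervalIntegral.integral_Iic_add_Ioi hf.integrableOn hf.integrableOn]

theorem isTempered_oddExt_pow (n : ℕ) : IsTempered (oddExt fun z => (z : ℂ) ^ n) := by
  have h : oddExt (fun z => (z : ℂ) ^ n) = fun x : ℝ =>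
      (Real.sign x : ℂ) * ((|x| : ℝ) : ℂ) ^ n := by
    ext x
    exact oddExt_eq_sign_mul _ x
  refine IsTempered.of_norm_le ?_ n 1 fun x => (norm_oddExt_le _ x).trans ?_
  · rw [h]
    exact (measurable_sign.mul (by fun_prop)).aestronglyMeasurable
  · rw [norm_pow, Complex.norm_real, Real.norm_eq_abs, abs_abs, one_mul]
    gcongr
    linarith

theorem pvInv_apply (φ : 𝓢(ℝ, ℂ)) :
    pvInv φ = ∫ x in Set.Ioi (0 : ℝ), (φ x - φ (-x)) / (x : ℂ) := rfl

/-- Riemann–Lebesgue at R and at -R, averaged. -/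
theorem tendsto_integral_mul_cos {s : Set ℝ} (hs : MeasurableSet s) {G : ℝ → ℂ}
    (hG : IntegrableOn G s) :
    Tendsto (fun R : ℝ => ∫ ν in s, G ν * (Real.cos (2 * Real.pi * ν * R) : ℂ))
      atTop (𝓝 0) := by
  have h0 := Real.zero_at_infty_fourier (s.indicator G)
  have h1 := h0.comp (tendsto_id.mono_right atTop_le_cocompact)
  have h2 := h0.comp (tendsto_neg_atTop_atBot.mono_right atBot_le_cocompact)
  have h3 := (h1.add h2).const_mul (1 / 2 : ℂ)
  simp only [add_zero, mul_zero] at h3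
  have hfour : ∀ w : ℝ, 𝓕 (s.indicator G) w =
      ∫ ν in s, Complex.exp (((-2 * Real.pi * ν * w : ℝ) : ℂ) * Complex.I) * G ν := fun w => by
    rw [Real.fourier_real_eq_integral_exp_smul, ← integral_indicator hs]
    congr 1
    ext ν
    by_cases hν : ν ∈ s <;> simp [hν]
  have hInt : ∀ w : ℝ, IntegrableOn
      (fun ν : ℝ => Complex.exp (((-2 * Real.pi * ν * w : ℝ) : ℂ) * Complex.I) * G ν) s :=
    fun w => by
    refine hG.bdd_mul (c := 1) (Continuous.aestronglyMeasurable (by fun_prop))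
      (Eventually.of_forall fun ν => ?_)
    rw [Complex.norm_exp_ofReal_mul_I]
  refine h3.congr fun R => ?_
  simp only [Function.comp_apply, id]
  rw [hfour, hfour, ← integral_add (hInt _) (hInt _), ← integral_const_mul]
  congr 1
  ext ν
  have e1 : ((-2 * Real.pi * ν * R : ℝ) : ℂ) = -((2 * Real.pi * ν * R : ℝ) : ℂ) := by
    push_cast; ring
  have e2 : ((-2 * Real.pi * ν * -R : ℝ) : ℂ) = ((2 * Real.pi * ν * R : ℝ) : ℂ) := by
    push_cast; ring
  rw [e1, e2, Complex.ofReal_cos, Complex.cos]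
  ring

theorem integral_sin_mul_const {ν : ℝ} (hν : ν ≠ 0) (R : ℝ) :
    ∫ t in (0 : ℝ)..R, (Real.sin (2 * Real.pi * ν * t) : ℂ) * 1 =
      (1 - (Real.cos (2 * Real.pi * ν * R) : ℂ)) / (2 * Real.pi * ν) := by
  have hw : 2 * Real.pi * ν ≠ 0 := mul_ne_zero (by positivity) hν
  simp_rw [mul_one]
  rw [intervalIntegral.integral_ofReal, intervalIntegral.integral_comp_mul_left _ hw]
  rw [integral_sin]
  simp
  field_simp

/-- The truncated transform is -(i/π)(1 - cos(2πνR))/ν, which is not bounded uniformly in R, so the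
criterion used for resonances does not apply. Folding the pairing onto ν > 0 gives the principal
value minus a cosine integral that tends to 0. -/
theorem fourier_dist_oddExt_one (φ : 𝓢(ℝ, ℂ)) :
    𝓕 (dist (oddExt fun _ => 1)) φ = -(Complex.I / Real.pi) * pvInv φ := by
  have hT : IsTempered (oddExt fun _ => 1) := by simpa using isTempered_oddExt_pow 0
  refine tendsto_nhds_unique (tendsto_integral_mul_truncFourier hT φ) ?_
  have hInt : ∀ n : ℕ, Integrable fun ν => φ ν * truncFourier (oddExt fun _ => 1) n ν := fun n => by
    have hc := continuous_truncFourier hT n.cast_nonneg (R := n)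
    refine φ.integrable.mul_bdd (c := ∫ t, ‖(Set.Ioc (-(n : ℝ)) n).indicator
      (oddExt fun _ => 1) t‖) hc.aestronglyMeasurable (Eventually.of_forall fun ν => ?_)
    rw [truncFourier_eq_fourier _ n.cast_nonneg]
    exact VectorFourier.norm_fourierIntegral_le_integral_norm _ _ _ _ _
  have heq : ∀ n : ℕ, ∫ ν, φ ν * truncFourier (oddExt fun _ => 1) n ν =
      -(Complex.I / Real.pi) * (pvInv φ - ∫ ν in Set.Ioi (0 : ℝ),
        (φ ν - φ (-ν)) / (ν : ℂ) * (Real.cos (2 * Real.pi * ν * n) : ℂ)) := fun n => by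
    have hcos : IntegrableOn (fun ν : ℝ => (φ ν - φ (-ν)) / (ν : ℂ) *
        (Real.cos (2 * Real.pi * ν * n) : ℂ)) (Set.Ioi 0) := by
      refine (pv_integrable φ).mul_bdd (c := 1) (Continuous.aestronglyMeasurable (by fun_prop))
        (Eventually.of_forall fun ν => ?_)
      rw [Complex.norm_real]
      exact Real.abs_cos_le_one _
    rw [integral_eq_integral_Ioi_add_neg (hInt n), pvInv_apply,
      ← integral_sub (pv_integrable φ) hcos, ← integral_const_mul]
    refine setIntegral_congr_fun measurableSet_Ioi fun ν hν => ?_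
    have hν0 : ν ≠ 0 := (Set.mem_Ioi.1 hν).ne'
    have hνc : (ν : ℂ) ≠ 0 := by exact_mod_cast hν0
    have hpi : (Real.pi : ℂ) ≠ 0 := by exact_mod_cast Real.pi_ne_zero
    rw [truncFourier_oddExt n.cast_nonneg intervalIntegrable_const,
      truncFourier_oddExt n.cast_nonneg intervalIntegrable_const,
      integral_sin_mul_const hν0, integral_sin_mul_const (neg_ne_zero.2 hν0)]
    have hc : Real.cos (2 * Real.pi * -ν * n) = Real.cos (2 * Real.pi * ν * n) := by
      rw [← Real.cos_neg]
      congr 1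
      ring
    rw [hc]
    push_cast
    field_simp
    ring
  simp_rw [heq]
  have h1 := (tendsto_integral_mul_cos measurableSet_Ioi (pv_integrable φ)).comp
    (tendsto_natCast_atTop_atTop (R := ℝ))
  simpa using (h1.const_sub (pvInv φ)).const_mul (-(Complex.I / Real.pi))

theorem integral_fourier_eq (φ : 𝓢(ℝ, ℂ)) : ∫ x, 𝓕 φ x = φ 0 := by
  have h : (𝓕⁻ (𝓕 φ)) 0 = φ 0 := by rw [fourierInv_fourier_eq]
  rw [← h, SchwartzMap.fourierInv_coe, Real.fourierInv_eq]
  simp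

theorem fourier_iterate_deriv (n : ℕ) (φ : 𝓢(ℝ, ℂ)) (x : ℝ) :
    𝓕 ((SchwartzMap.derivCLM ℂ ℂ)^[n] φ) x =
      (2 * Real.pi * Complex.I * x) ^ n * 𝓕 φ x := by
  induction n generalizing φ with
  | zero => simp
  | succ n ih =>
    have h1 : 𝓕 (SchwartzMap.derivCLM ℂ ℂ φ) x = (2 * Real.pi * Complex.I * x) * 𝓕 φ x := by
      have hd : ⇑(SchwartzMap.derivCLM ℂ ℂ φ) = deriv φ := by
        ext y
        exact SchwartzMap.derivCLM_apply ℂ φ y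
      have h2 := Real.fourier_deriv φ.integrable φ.differentiable
        (by rw [← hd]; exact (SchwartzMap.derivCLM ℂ ℂ φ).integrable)
      rw [SchwartzMap.fourier_coe, hd, h2, SchwartzMap.fourier_coe]
      rfl
    rw [Function.iterate_succ_apply, ih, h1, pow_succ]
    ring

theorem iterDeriv_apply (n : ℕ) (u : 𝓢'(ℝ, ℂ)) (φ : 𝓢(ℝ, ℂ)) :
    iterDeriv n u φ = (-1) ^ n * u ((SchwartzMap.derivCLM ℂ ℂ)^[n] φ) := by
  induction n generalizing φ with
  | zero => simp [iterDeriv]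
  | succ n ih =>
    rw [iterDeriv] at ih ⊢
    rw [Function.iterate_succ_apply', TemperedDistribution.derivCLM_apply_apply, map_neg, ih,
      Function.iterate_succ_apply, pow_succ]
    ring

/-- With ψ the n-th derivative of φ, x^n 𝓕φ = (2πi)⁻ⁿ 𝓕ψ. For even n this leaves the sign function
tested on 𝓕ψ; for odd n the odd extension is x^n itself and ∫ 𝓕ψ = ψ(0). -/
theorem fourier_dist_oddExt_pow (n : ℕ) :
    𝓕 (dist (oddExt fun z => (z : ℂ) ^ n)) = Fhat n := by
  have hpi : (Real.pi : ℂ) ≠ 0 := by exact_mod_cast Real.pi_ne_zero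
  have h2pi : (2 * Real.pi * Complex.I : ℂ) ^ n ≠ 0 :=
    pow_ne_zero _ (mul_ne_zero (mul_ne_zero two_ne_zero hpi) Complex.I_ne_zero)
  ext φ
  set ψ := (SchwartzMap.derivCLM ℂ ℂ)^[n] φ with hψ
  have hF : ∀ x : ℝ, 𝓕 φ x * (x : ℂ) ^ n = ((2 * Real.pi * Complex.I : ℂ) ^ n)⁻¹ * 𝓕 ψ x :=
    fun x => by
    rw [hψ, fourier_iterate_deriv, mul_pow _ (x : ℂ), ← mul_assoc, inv_mul_cancel_left₀ h2pi]
    ring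
  rw [TemperedDistribution.fourier_apply, dist_apply (isTempered_oddExt_pow n), Fhat]
  rcases Nat.even_or_odd n with hn | hn
  · rw [if_pos hn]
    have h1 : ∀ x : ℝ, 𝓕 φ x * oddExt (fun z => (z : ℂ) ^ n) x =
        ((2 * Real.pi * Complex.I : ℂ) ^ n)⁻¹ * (𝓕 ψ x * oddExt (fun _ => 1) x) := fun x => by
      rw [oddExt_eq_sign_mul, oddExt_eq_sign_mul, ← Complex.ofReal_pow, hn.pow_abs,
        Complex.ofReal_pow]
      linear_combination (Real.sign x : ℂ) * hF x
    have h2 := fourier_dist_oddExt_one ψ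
    rw [TemperedDistribution.fourier_apply,
      dist_apply (by simpa using isTempered_oddExt_pow 0)] at h2
    simp_rw [h1]
    rw [integral_const_mul, h2, invPow, _root_.smul_apply, _root_.smul_apply, iterDeriv_apply,
      ← hψ, smul_eq_mul, smul_eq_mul]
    obtain ⟨l, rfl⟩ := hn
    have hl : (l + l) / 2 = l := by omega
    have hf : ((l + l).factorial : ℂ) ≠ 0 := by exact_mod_cast (l + l).factorial_ne_zero
    have hI : Complex.I ^ (l + l) = (-1) ^ l := by
      rw [← two_mul, pow_mul, Complex.I_sq]
    have hm : ((-1 : ℂ) ^ l) * (-1) ^ l = 1 := by rw [← mul_pow]; simp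
    rw [hl, mul_pow _ Complex.I, hI, pow_add (-1 : ℂ) l l, hm, pow_succ, pow_succ (2 * _) (l + l)]
    have hm0 : ((-1 : ℂ) ^ l) ≠ 0 := pow_ne_zero _ (by norm_num)
    field_simp
    linear_combination (pvInv ψ) * hm
  · rw [if_neg (Nat.not_even_iff_odd.2 hn)]
    have h1 : ∀ x : ℝ, 𝓕 φ x * oddExt (fun z => (z : ℂ) ^ n) x =
        ((2 * Real.pi * Complex.I : ℂ) ^ n)⁻¹ * 𝓕 ψ x := fun x => by
      rw [← hF, oddExt]
      split_ifs with h2 h3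
      · rfl
      · simp [h3, hn.pos.ne']
      · push_cast
        rw [hn.neg_pow, neg_neg]
    simp_rw [h1]
    rw [integral_const_mul, integral_fourier_eq, _root_.smul_apply, iterDeriv_apply, ← hψ,
      smul_eq_mul, TemperedDistribution.delta_apply]
    obtain ⟨l, rfl⟩ := hn
    have hl : (2 * l + 1) / 2 = l := by omega
    have hI : Complex.I ^ (2 * l + 1) = (-1) ^ l * Complex.I := by
      rw [pow_succ, pow_mul, Complex.I_sq]
    have hm : ((-1 : ℂ) ^ l) * (-1) ^ l = 1 := by rw [← mul_pow]; simp
    have hm0 : ((-1 : ℂ) ^ l) ≠ 0 := pow_ne_zero _ (by norm_num)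
    rw [hl, mul_pow _ Complex.I, hI, pow_succ (-1 : ℂ) (2 * l), pow_mul]
    have hI0 := Complex.I_ne_zero
    field_simp
    simp only [Complex.I_sq]
    linear_combination (-(ψ 0)) * hm

/-! ### Convolution of tempered functions with Schwartz functions -/

/-- Peetre's inequality: growth in y is paid for by growth in x and by decay of the kernel in x - y.
-/
theorem one_add_abs_le_mul (x y : ℝ) : 1 + |y| ≤ (1 + |x|) * (1 + |x - y|) := by
  have h := abs_sub_abs_le_abs_sub y x
  rw [abs_sub_comm] at h
  nlinarith [mul_nonneg (abs_nonneg x) (abs_nonneg (x - y))]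

/-- Only the constant C of the kernel enters, so a family of kernels with a common C has a common
dominating function. -/
theorem norm_mul_comp_sub_le {s K : ℝ → ℂ} {m : ℕ} {C : ℝ}
    (hK : ∀ u, ‖K u‖ * (1 + |u|) ^ m ≤ C) (x y : ℝ) :
    ‖s y * K (x - y)‖ ≤ C * (1 + |x|) ^ m * ‖((((1 + |y|) ^ m)⁻¹ : ℝ) : ℂ) * s y‖ := by
  rw [norm_weight_mul, norm_mul]
  have hy : 0 < (1 + |y|) ^ m := by positivity
  have h1 : ‖K (x - y)‖ ≤ C * (1 + |x|) ^ m * ((1 + |y|) ^ m)⁻¹ := by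
    rw [← div_eq_mul_inv, le_div_iff₀ hy]
    calc ‖K (x - y)‖ * (1 + |y|) ^ m
        ≤ ‖K (x - y)‖ * ((1 + |x|) * (1 + |x - y|)) ^ m := by
          gcongr
          exact one_add_abs_le_mul x y
      _ = (‖K (x - y)‖ * (1 + |x - y|) ^ m) * (1 + |x|) ^ m := by rw [mul_pow]; ring
      _ ≤ C * (1 + |x|) ^ m := by gcongr; exact hK _
  calc ‖s y‖ * ‖K (x - y)‖ ≤ ‖s y‖ * (C * (1 + |x|) ^ m * ((1 + |y|) ^ m)⁻¹) := by gcongr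
    _ = _ := by ring

theorem exists_norm_mul_one_add_pow_le (K : 𝓢(ℝ, ℂ)) (m : ℕ) :
    ∃ C : ℝ, ∀ u, ‖K u‖ * (1 + |u|) ^ m ≤ C :=
  ⟨_, fun u => (mul_comm _ _).trans_le (weight_bound m K u)⟩

theorem IsTempered.integrable_mul_comp_sub {s : ℝ → ℂ} (hs : IsTempered s) (K : 𝓢(ℝ, ℂ))
    (x : ℝ) : Integrable fun y => s y * K (x - y) := by
  have hmeas := hs.aestronglyMeasurable
  obtain ⟨m, hm⟩ := hs
  obtain ⟨C, hC⟩ := exists_norm_mul_one_add_pow_le K m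
  refine (hm.norm.const_mul (C * (1 + |x|) ^ m)).mono' (hmeas.mul ?_)
    (Eventually.of_forall (norm_mul_comp_sub_le hC x))
  have := K.continuous
  exact Continuous.aestronglyMeasurable (by fun_prop)

theorem aestronglyMeasurable_prod_mul_comp_sub {s : ℝ → ℂ} (hs : AEStronglyMeasurable s)
    (K : 𝓢(ℝ, ℂ)) :
    AEStronglyMeasurable (fun z : ℝ × ℝ => s z.2 * K (z.1 - z.2)) (volume.prod volume) := by
  have := K.continuous
  exact hs.comp_snd.mul (Continuous.aestronglyMeasurable (by fun_prop))

theorem IsTempered.convolution {s : ℝ → ℂ} (hs : IsTempered s) (K : 𝓢(ℝ, ℂ)) :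
    IsTempered fun x => ∫ y, s y * K (x - y) := by
  have hmeas := (aestronglyMeasurable_prod_mul_comp_sub hs.aestronglyMeasurable K).integral_prod_right'
  obtain ⟨m, hm⟩ := hs
  obtain ⟨C, hC⟩ := exists_norm_mul_one_add_pow_le K m
  refine IsTempered.of_norm_le hmeas m
    (C * ∫ y : ℝ, ‖((((1 + |y|) ^ m)⁻¹ : ℝ) : ℂ) * s y‖) fun x => ?_
  refine (norm_integral_le_of_norm_le (hm.norm.const_mul (C * (1 + |x|) ^ m))
    (Eventually.of_forall (norm_mul_comp_sub_le hC x))).trans ?_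
  rw [integral_const_mul]
  exact le_of_eq (by ring)

theorem isTempered_one_add_abs_pow (m : ℕ) : IsTempered fun x => (((1 + |x|) ^ m : ℝ) : ℂ) := by
  refine IsTempered.of_norm_le (Continuous.aestronglyMeasurable (by fun_prop)) m 1 fun x => ?_
  rw [Complex.norm_real, Real.norm_of_nonneg (by positivity), one_mul]

theorem integrable_prod_mul_comp_sub {s : ℝ → ℂ} (hs : IsTempered s) (K φ : 𝓢(ℝ, ℂ)) :
    Integrable (fun z : ℝ × ℝ => φ z.1 * (s z.2 * K (z.1 - z.2))) (volume.prod volume) := by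
  have hmeas := aestronglyMeasurable_prod_mul_comp_sub hs.aestronglyMeasurable K
  obtain ⟨m, hm⟩ := hs
  obtain ⟨C, hC⟩ := exists_norm_mul_one_add_pow_le K m
  have h1 := ((isTempered_one_add_abs_pow m).integrable_mul φ).norm.const_mul C
  refine (h1.mul_prod hm.norm).mono' ?_ (Eventually.of_forall fun z => ?_)
  · have := φ.continuous
    exact (Continuous.aestronglyMeasurable (by fun_prop)).mul hmeas
  · rw [norm_mul, norm_mul (φ z.1), Complex.norm_real, Real.norm_of_nonneg (by positivity)]
    calc ‖φ z.1‖ * ‖s z.2 * K (z.1 - z.2)‖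
        ≤ ‖φ z.1‖ * (C * (1 + |z.1|) ^ m * ‖((((1 + |z.2|) ^ m)⁻¹ : ℝ) : ℂ) * s z.2‖) := by
          gcongr
          exact norm_mul_comp_sub_le hC _ _
      _ = _ := by ring

theorem fourier_comp_sub (f : ℝ → ℂ) (y ν : ℝ) :
    𝓕 (fun x => f (x - y)) ν =
      Complex.exp (((-2 * Real.pi * y * ν : ℝ) : ℂ) * Complex.I) * 𝓕 f ν := by
  rw [Real.fourier_real_eq_integral_exp_smul, Real.fourier_real_eq_integral_exp_smul,
    ← integral_const_mul, ← integral_add_right_eq_self _ y]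
  congr 1
  ext x
  rw [add_sub_cancel_right, smul_eq_mul, smul_eq_mul, ← mul_assoc, ← Complex.exp_add]
  congr 2
  push_cast
  ring

theorem integral_fourier_mul_comp_sub (K φ : 𝓢(ℝ, ℂ)) (y : ℝ) :
    ∫ x, 𝓕 φ x * K (x - y) = 𝓕 (fun ν => 𝓕 K ν * φ ν) y := by
  rw [SchwartzMap.fourier_coe φ,
    integral_fourier_mul_eq φ.integrable (K.integrable.comp_sub_right y),
    Real.fourier_real_eq_integral_exp_smul]
  congr 1
  ext ν
  rw [fourier_comp_sub, SchwartzMap.fourier_coe, smul_eq_mul,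
    show -2 * Real.pi * y * ν = -2 * Real.pi * ν * y by ring]
  ring

/-- Tested on φ, Fubini puts s outside; the inner integral of 𝓕φ(x) K(x - y) is the transform of 𝓕K
· φ at y, because a translation becomes a modulation. -/
theorem fourier_dist_convolution {s : ℝ → ℂ} (hs : IsTempered s) (K : 𝓢(ℝ, ℂ)) :
    𝓕 (dist fun x => ∫ y, s y * K (x - y)) =
      TemperedDistribution.smulLeftCLM ℂ ⇑(𝓕 K : 𝓢(ℝ, ℂ)) (𝓕 (dist s)) := by
  ext φ
  rw [TemperedDistribution.fourier_apply, dist_apply (hs.convolution K),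
    TemperedDistribution.smulLeftCLM_apply_apply, TemperedDistribution.fourier_apply,
    dist_apply hs]
  simp_rw [← integral_const_mul]
  rw [integral_integral_swap (integrable_prod_mul_comp_sub hs K (𝓕 φ))]
  congr 1
  ext y
  have h1 : ⇑(SchwartzMap.smulLeftCLM ℂ ⇑(𝓕 K : 𝓢(ℝ, ℂ)) φ) = fun ν => 𝓕 K ν * φ ν := by
    ext ν
    rw [SchwartzMap.smulLeftCLM_apply_apply (𝓕 K : 𝓢(ℝ, ℂ)).hasTemperateGrowth, smul_eq_mul]
  rw [SchwartzMap.fourier_coe (SchwartzMap.smulLeftCLM ℂ _ φ), h1, ← integral_fourier_mul_comp_sub, ← integral_mul_const]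
  congr 1
  ext x
  ring

/-! ### Polynomials times Gaussians as Schwartz functions -/

/-- Uses |x|ⁿ ≤ 1 + x²ⁿ and uⁿ/n! ≤ eᵘ with u = bx². -/
theorem abs_pow_mul_exp_neg_le {b : ℝ} (hb : 0 < b) (n : ℕ) (x : ℝ) :
    |x| ^ n * Real.exp (-(b * x ^ 2)) ≤ 1 + n.factorial / b ^ n := by
  have h1 : |x| ^ n ≤ 1 + (x ^ 2) ^ n := by
    rw [← sq_abs, ← pow_mul, mul_comm 2 n, pow_mul]
    nlinarith [sq_nonneg (|x| ^ n - 1), sq_nonneg (|x| ^ n)]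
  have h2 := Real.pow_div_factorial_le_exp (b * x ^ 2) (by positivity) n
  have h3 : (x ^ 2) ^ n ≤ n.factorial / b ^ n * Real.exp (b * x ^ 2) := by
    rw [mul_pow, div_le_iff₀ (by positivity)] at h2
    rw [div_mul_eq_mul_div, le_div_iff₀ (by positivity)]
    linarith
  have h4 : Real.exp (-(b * x ^ 2)) ≤ 1 := by
    rw [Real.exp_le_one_iff]
    have : 0 ≤ b * x ^ 2 := by positivity
    linarith
  have h5 : Real.exp (b * x ^ 2) * Real.exp (-(b * x ^ 2)) = 1 := by
    rw [← Real.exp_add]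
    simp
  calc |x| ^ n * Real.exp (-(b * x ^ 2))
      ≤ (1 + n.factorial / b ^ n * Real.exp (b * x ^ 2)) * Real.exp (-(b * x ^ 2)) := by
        gcongr
        exact h1.trans (by linarith)
    _ = Real.exp (-(b * x ^ 2)) + n.factorial / b ^ n := by
        rw [add_mul, one_mul, mul_assoc, h5, mul_one]
    _ ≤ _ := by linarith

theorem exists_norm_eval_mul_exp_neg_le {b : ℝ} (hb : 0 < b) (n : ℕ) (P : Polynomial ℂ) :
    ∃ C : ℝ, ∀ x : ℝ, |x| ^ n * ‖P.eval (x : ℂ) * (Real.exp (-(b * x ^ 2)) : ℂ)‖ ≤ C := by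
  induction P using Polynomial.induction_on' with
  | add P Q hP hQ =>
    obtain ⟨C, hC⟩ := hP
    obtain ⟨D, hD⟩ := hQ
    refine ⟨C + D, fun x => ?_⟩
    rw [Polynomial.eval_add, add_mul]
    calc _ ≤ |x| ^ n * (‖P.eval (x : ℂ) * (Real.exp (-(b * x ^ 2)) : ℂ)‖ +
          ‖Q.eval (x : ℂ) * (Real.exp (-(b * x ^ 2)) : ℂ)‖) := by
          gcongr
          exact norm_add_le _ _
      _ ≤ C + D := by rw [mul_add]; exact add_le_add (hC x) (hD x)
  | monomial i c =>
    refine ⟨‖c‖ * (1 + (n + i).factorial / b ^ (n + i)), fun x => ?_⟩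
    rw [Polynomial.eval_monomial, norm_mul, norm_mul, norm_pow, Complex.norm_real,
      Complex.norm_real, Real.norm_of_nonneg (Real.exp_pos _).le, Real.norm_eq_abs]
    calc _ = ‖c‖ * (|x| ^ (n + i) * Real.exp (-(b * x ^ 2))) := by rw [pow_add]; ring
      _ ≤ _ := by gcongr; exact abs_pow_mul_exp_neg_le hb _ x

theorem hasDerivAt_eval_mul_exp_neg (b : ℝ) (P : Polynomial ℂ) (x : ℝ) :
    HasDerivAt (fun x : ℝ => P.eval (x : ℂ) * (Real.exp (-(b * x ^ 2)) : ℂ))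
      ((Polynomial.derivative P - Polynomial.C (2 * b : ℂ) * Polynomial.X * P).eval (x : ℂ) *
        (Real.exp (-(b * x ^ 2)) : ℂ)) x := by
  have h1 : HasDerivAt (fun x : ℝ => P.eval (x : ℂ))
      ((Polynomial.derivative P).eval (x : ℂ)) x := (P.hasDerivAt (x : ℂ)).comp_ofReal
  have h2 : HasDerivAt (fun x : ℝ => Real.exp (-(b * x ^ 2)))
      (Real.exp (-(b * x ^ 2)) * (-(b * (2 * x)))) x := by
    refine (((hasDerivAt_pow 2 x).const_mul b).neg.exp).congr_deriv ?_
    simp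
  refine (h1.mul h2.ofReal_comp).congr_deriv ?_
  simp
  ring

/-- Polynomial multiples of a Gaussian are closed under differentiation, so Schwartz decay need only
be checked without derivatives. -/
theorem exists_iteratedDeriv_eval_mul_exp_neg (b : ℝ) (n : ℕ) (P : Polynomial ℂ) :
    ∃ Q : Polynomial ℂ,
      iteratedDeriv n (fun x : ℝ => P.eval (x : ℂ) * (Real.exp (-(b * x ^ 2)) : ℂ)) =
        fun x : ℝ => Q.eval (x : ℂ) * (Real.exp (-(b * x ^ 2)) : ℂ) := by
  induction n with
  | zero => exact ⟨P, by simp⟩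
  | succ n ih =>
    obtain ⟨Q, hQ⟩ := ih
    refine ⟨Polynomial.derivative Q - Polynomial.C (2 * b : ℂ) * Polynomial.X * Q, ?_⟩
    rw [iteratedDeriv_succ, hQ]
    ext x
    exact (hasDerivAt_eval_mul_exp_neg b Q x).deriv

/-- The Schwartz function `x ↦ P(x) exp(-b x²)`. -/
noncomputable def gaussPoly {b : ℝ} (hb : 0 < b) (P : Polynomial ℂ) : 𝓢(ℝ, ℂ) where
  toFun x := P.eval (x : ℂ) * (Real.exp (-(b * x ^ 2)) : ℂ)
  smooth' := by
    have h1 : ContDiff ℝ ∞ fun x : ℝ => P.eval (x : ℂ) :=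
      ((P.contDiff_aeval (𝕜 := ℂ) ∞).restrict_scalars ℝ).comp Complex.ofRealCLM.contDiff
    have h2 : ContDiff ℝ ∞ fun x : ℝ => Real.exp (-(b * x ^ 2)) := by fun_prop
    exact h1.mul (Complex.ofRealCLM.contDiff.comp h2)
  decay' k n := by
    obtain ⟨Q, hQ⟩ := exists_iteratedDeriv_eval_mul_exp_neg b n P
    obtain ⟨C, hC⟩ := exists_norm_eval_mul_exp_neg_le hb k Q
    refine ⟨C, fun x => ?_⟩
    rw [norm_iteratedFDeriv_eq_norm_iteratedDeriv, hQ, Real.norm_eq_abs]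
    exact hC x

theorem gaussPoly_apply {b : ℝ} (hb : 0 < b) (P : Polynomial ℂ) (x : ℝ) :
    gaussPoly hb P x = P.eval (x : ℂ) * (Real.exp (-(b * x ^ 2)) : ℂ) := rfl

/-! ### The heat kernel and its derivatives -/

/-- The Fourier transform `(iπν)^(2k) exp(-π²τν²)` of the `k`-th derivative in `τ` of the heat
kernel `exp(-z²/τ) / √(πτ)`. -/
noncomputable def heatSymbol (k : ℕ) (τ ν : ℝ) : ℂ :=
  (Complex.I * (Real.pi : ℂ) * (ν : ℂ)) ^ (2 * k) * (Real.exp (-(Real.pi ^ 2 * τ * ν ^ 2)) : ℂ)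

theorem exists_schwartz_eq_heatSymbol (k : ℕ) {τ : ℝ} (hτ : 0 < τ) :
    ∃ M : 𝓢(ℝ, ℂ), ⇑M = heatSymbol k τ := by
  refine ⟨gaussPoly (b := Real.pi ^ 2 * τ) (by positivity)
    ((Polynomial.C (Complex.I * Real.pi) * Polynomial.X) ^ (2 * k)), ?_⟩
  ext ν
  simp [gaussPoly_apply, heatSymbol]

/-- The `k`-th derivative in `τ` of the heat kernel `exp(-z²/τ) / √(πτ)`. -/
noncomputable def heatKernel (k : ℕ) (τ z : ℝ) : ℂ := 𝓕⁻ (heatSymbol k τ) z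

theorem exists_schwartz_eq_heatKernel (k : ℕ) {τ : ℝ} (hτ : 0 < τ) :
    ∃ K : 𝓢(ℝ, ℂ), ⇑K = heatKernel k τ ∧ ⇑(𝓕 K : 𝓢(ℝ, ℂ)) = heatSymbol k τ := by
  obtain ⟨M, hM⟩ := exists_schwartz_eq_heatSymbol k hτ
  refine ⟨𝓕⁻ M, ?_, ?_⟩
  · rw [SchwartzMap.fourierInv_coe, hM]
    rfl
  · rw [fourier_fourierInv_eq, hM]

theorem integrable_heatSymbol (k : ℕ) {τ : ℝ} (hτ : 0 < τ) : Integrable (heatSymbol k τ) := by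
  obtain ⟨M, hM⟩ := exists_schwartz_eq_heatSymbol k hτ
  rw [← hM]
  exact M.integrable

theorem heatKernel_eq_integral (k : ℕ) (τ z : ℝ) :
    heatKernel k τ z =
      ∫ ν : ℝ, Complex.exp (((2 * Real.pi * ν * z : ℝ) : ℂ) * Complex.I) * heatSymbol k τ ν := by
  rw [heatKernel, Real.fourierInv_eq']
  congr 1
  ext ν
  rw [smul_eq_mul]
  congr 3
  simp
  ring

theorem hasDerivAt_heatSymbol (k : ℕ) (τ ν : ℝ) :
    HasDerivAt (fun τ => heatSymbol k τ ν) (heatSymbol (k + 1) τ ν) τ := by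
  have h1 : HasDerivAt (fun τ : ℝ => Real.exp (-(Real.pi ^ 2 * τ * ν ^ 2)))
      (Real.exp (-(Real.pi ^ 2 * τ * ν ^ 2)) * (-(Real.pi ^ 2 * ν ^ 2))) τ := by
    refine ((((hasDerivAt_id τ).const_mul (Real.pi ^ 2)).mul_const (ν ^ 2)).neg.exp).congr_deriv ?_
    simp
  refine (h1.ofReal_comp.const_mul _).congr_deriv ?_
  rw [heatSymbol, mul_add, mul_one, pow_add]
  push_cast
  linear_combination (-(Complex.I * (Real.pi : ℂ) * (ν : ℂ)) ^ (2 * k) *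
    Complex.exp (-((Real.pi : ℂ) ^ 2 * τ * ν ^ 2)) * (Real.pi : ℂ) ^ 2 * (ν : ℂ) ^ 2) *
      Complex.I_sq

theorem norm_heatSymbol_le (k : ℕ) {τ τ' : ℝ} (h : τ' ≤ τ) (ν : ℝ) :
    ‖heatSymbol k τ ν‖ ≤ ‖heatSymbol k τ' ν‖ := by
  rw [heatSymbol, heatSymbol, norm_mul, norm_mul, Complex.norm_real, Complex.norm_real,
    Real.norm_of_nonneg (Real.exp_pos _).le, Real.norm_of_nonneg (Real.exp_pos _).le]
  gcongr

theorem hasDerivAt_heatKernel (k : ℕ) {τ : ℝ} (hτ : 0 < τ) (z : ℝ) :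
    HasDerivAt (fun τ => heatKernel k τ z) (heatKernel (k + 1) τ z) τ := by
  have hc : Continuous fun ν : ℝ =>
      Complex.exp (((2 * Real.pi * ν * z : ℝ) : ℂ) * Complex.I) := by fun_prop
  have hm : ∀ (j : ℕ) (τ : ℝ), Continuous (heatSymbol j τ) := fun j τ => by
    unfold heatSymbol
    fun_prop
  simp_rw [heatKernel_eq_integral]
  refine (hasDerivAt_integral_of_dominated_loc_of_deriv_le
    (F := fun τ ν => Complex.exp (((2 * Real.pi * ν * z : ℝ) : ℂ) * Complex.I) * heatSymbol k τ ν)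
    (F' := fun τ ν =>
      Complex.exp (((2 * Real.pi * ν * z : ℝ) : ℂ) * Complex.I) * heatSymbol (k + 1) τ ν)
    -- The symbol decreases in modulus as τ grows, so its value at τ/2 dominates on the
    -- neighbourhood (τ/2, ∞).
    (bound := fun ν => ‖heatSymbol (k + 1) (τ / 2) ν‖)
    (Ioi_mem_nhds (show τ / 2 < τ by linarith))
    (Eventually.of_forall fun τ => (hc.mul (hm k τ)).aestronglyMeasurable) ?_
    (hc.mul (hm (k + 1) τ)).aestronglyMeasurable (Eventually.of_forall fun ν τ' hτ' => ?_)
    (integrable_heatSymbol _ (by linarith)).norm (Eventually.of_forall fun ν τ' _ => ?_)).2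
  · refine (integrable_heatSymbol k hτ).bdd_mul (c := 1) hc.aestronglyMeasurable
      (Eventually.of_forall fun ν => ?_)
    rw [Complex.norm_exp_ofReal_mul_I]
  · rw [norm_mul, Complex.norm_exp_ofReal_mul_I, one_mul]
    exact norm_heatSymbol_le _ (le_of_lt hτ') ν
  · exact (hasDerivAt_heatSymbol k τ' ν).const_mul _

theorem heatSymbol_eq_scaled (k : ℕ) {b : ℝ} (hb : 0 < b) (ν : ℝ) :
    heatSymbol k (b ^ 2) ν = ((b : ℂ) ^ (2 * k))⁻¹ * heatSymbol k 1 (b * ν) := by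
  have hb0 : (b : ℂ) ^ (2 * k) ≠ 0 := pow_ne_zero _ (by exact_mod_cast hb.ne')
  rw [heatSymbol, heatSymbol, ← mul_assoc, Complex.ofReal_mul,
    show Complex.I * (Real.pi : ℂ) * ((b : ℂ) * ν) = b * (Complex.I * (Real.pi : ℂ) * ν) by ring,
    mul_pow (b : ℂ), inv_mul_cancel_left₀ hb0]
  congr 4
  ring

theorem heatKernel_eq_scaled (k : ℕ) {b : ℝ} (hb : 0 < b) (z : ℝ) :
    heatKernel k (b ^ 2) z = ((b : ℂ) ^ (2 * k + 1))⁻¹ * heatKernel k 1 (z / b) := by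
  rw [heatKernel_eq_integral, heatKernel_eq_integral]
  have h := Measure.integral_comp_mul_left (fun ν : ℝ =>
    Complex.exp (((2 * Real.pi * ν * (z / b) : ℝ) : ℂ) * Complex.I) * heatSymbol k 1 ν) b
  rw [abs_of_pos (inv_pos.2 hb)] at h
  have hb0 : (b : ℂ) ≠ 0 := by exact_mod_cast hb.ne'
  rw [pow_succ (b : ℂ), mul_inv, mul_assoc, ← Complex.ofReal_inv b, ← Complex.real_smul, ← h,
    ← integral_const_mul]
  congr 1
  ext ν
  rw [heatSymbol_eq_scaled k hb,
    show 2 * Real.pi * (b * ν) * (z / b) = 2 * Real.pi * ν * z by field_simp]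
  ring

/-- Parabolic scaling reduces every τ to the single Schwartz function at τ = 1. The prefactor is
worst at τ₀ and the rescaled weight at τ₁. -/
theorem exists_norm_heatKernel_le (k m : ℕ) {τ₀ : ℝ} (hτ₀ : 0 < τ₀) (τ₁ : ℝ) :
    ∃ C : ℝ, ∀ τ ∈ Set.Icc τ₀ τ₁, ∀ z, ‖heatKernel k τ z‖ * (1 + |z|) ^ m ≤ C := by
  obtain ⟨K, hK, -⟩ := exists_schwartz_eq_heatKernel k one_pos
  obtain ⟨D, hD⟩ := exists_norm_mul_one_add_pow_le K m
  rw [hK] at hD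
  have hD0 : 0 ≤ D := (by positivity : (0 : ℝ) ≤ _).trans (hD 0)
  refine ⟨(Real.sqrt τ₀ ^ (2 * k + 1))⁻¹ * (1 + Real.sqrt τ₁) ^ m * D, fun τ hτ z => ?_⟩
  have hτ0 : 0 < τ := hτ₀.trans_le hτ.1
  have hb : 0 < Real.sqrt τ := Real.sqrt_pos.2 hτ0
  have hb0 : 0 < Real.sqrt τ₀ := Real.sqrt_pos.2 hτ₀
  have h1 : Real.sqrt τ₀ ≤ Real.sqrt τ := Real.sqrt_le_sqrt hτ.1
  have h2 : Real.sqrt τ ≤ Real.sqrt τ₁ := Real.sqrt_le_sqrt hτ.2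
  have h3 := heatKernel_eq_scaled k hb z
  rw [Real.sq_sqrt hτ0.le] at h3
  have h4 : 1 + |z| ≤ (1 + Real.sqrt τ₁) * (1 + |z / Real.sqrt τ|) := by
    have h5 : |z| = Real.sqrt τ * |z / Real.sqrt τ| := by
      rw [abs_div, abs_of_pos hb]
      field_simp
    have h6 : Real.sqrt τ * |z / Real.sqrt τ| ≤ Real.sqrt τ₁ * |z / Real.sqrt τ| := by gcongr
    nlinarith [abs_nonneg (z / Real.sqrt τ), Real.sqrt_nonneg τ₁]
  rw [h3, norm_mul, norm_inv, norm_pow, Complex.norm_real, Real.norm_of_nonneg hb.le]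
  calc (Real.sqrt τ ^ (2 * k + 1))⁻¹ * ‖heatKernel k 1 (z / Real.sqrt τ)‖ * (1 + |z|) ^ m
      ≤ (Real.sqrt τ₀ ^ (2 * k + 1))⁻¹ * ‖heatKernel k 1 (z / Real.sqrt τ)‖ *
        ((1 + Real.sqrt τ₁) * (1 + |z / Real.sqrt τ|)) ^ m := by gcongr
    _ = (Real.sqrt τ₀ ^ (2 * k + 1))⁻¹ * (1 + Real.sqrt τ₁) ^ m *
        (‖heatKernel k 1 (z / Real.sqrt τ)‖ * (1 + |z / Real.sqrt τ|) ^ m) := by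
        rw [mul_pow]; ring
    _ ≤ _ := by gcongr; exact hD _

/-- The convolution of `s` with the `k`-th derivative in `τ` of the heat kernel. -/
noncomputable def heatConv (s : ℝ → ℂ) (k : ℕ) (τ z : ℝ) : ℂ :=
  ∫ y, s y * heatKernel k τ (z - y)

theorem integrable_mul_heatKernel {s : ℝ → ℂ} (hs : IsTempered s) (k : ℕ) {τ : ℝ} (hτ : 0 < τ)
    (z : ℝ) : Integrable fun y => s y * heatKernel k τ (z - y) := by
  obtain ⟨K, hK, -⟩ := exists_schwartz_eq_heatKernel k hτ
  rw [← hK]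
  exact hs.integrable_mul_comp_sub K z

theorem hasDerivAt_heatConv {s : ℝ → ℂ} (hs : IsTempered s) (k : ℕ) {τ : ℝ} (hτ : 0 < τ)
    (z : ℝ) : HasDerivAt (fun τ => heatConv s k τ z) (heatConv s (k + 1) τ z) τ := by
  have hs' := hs
  obtain ⟨m, hm⟩ := hs
  -- A common kernel bound on [τ/2, 2τ] gives the dominating function for the differentiated
  -- integrand.
  obtain ⟨C, hC⟩ := exists_norm_heatKernel_le (k + 1) m (half_pos hτ) (2 * τ)
  have hpos : ∀ τ' ∈ Set.Ioo (τ / 2) (2 * τ), 0 < τ' := fun τ' h => (half_pos hτ).trans h.1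
  have hnhds : Set.Ioo (τ / 2) (2 * τ) ∈ 𝓝 τ := Ioo_mem_nhds (by linarith) (by linarith)
  refine (hasDerivAt_integral_of_dominated_loc_of_deriv_le
    (F := fun τ y => s y * heatKernel k τ (z - y))
    (F' := fun τ y => s y * heatKernel (k + 1) τ (z - y))
    (bound := fun y => C * (1 + |z|) ^ m * ‖((((1 + |y|) ^ m)⁻¹ : ℝ) : ℂ) * s y‖)
    hnhds ?_ (integrable_mul_heatKernel hs' k hτ z)
    (integrable_mul_heatKernel hs' (k + 1) hτ z).aestronglyMeasurable
    (Eventually.of_forall fun y τ' hτ' => ?_) (hm.norm.const_mul _)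
    (Eventually.of_forall fun y τ' hτ' => ?_)).2
  · filter_upwards [hnhds] with τ' hτ'
    exact (integrable_mul_heatKernel hs' k (hpos τ' hτ') z).aestronglyMeasurable
  · exact norm_mul_comp_sub_le (hC τ' ⟨hτ'.1.le, hτ'.2.le⟩) z y
  · exact (hasDerivAt_heatKernel k (hpos τ' hτ') (z - y)).const_mul _

theorem isTempered_heatConv {s : ℝ → ℂ} (hs : IsTempered s) (k : ℕ) {τ : ℝ} (hτ : 0 < τ) :
    IsTempered (heatConv s k τ) := by
  obtain ⟨K, hK, -⟩ := exists_schwartz_eq_heatKernel k hτ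
  unfold heatConv
  rw [← hK]
  exact hs.convolution K

theorem hasTemperateGrowth_heatSymbol (k : ℕ) {τ : ℝ} (hτ : 0 < τ) :
    Function.HasTemperateGrowth (heatSymbol k τ) := by
  obtain ⟨M, hM⟩ := exists_schwartz_eq_heatSymbol k hτ
  rw [← hM]
  exact M.hasTemperateGrowth

theorem fourier_dist_heatConv {s : ℝ → ℂ} (hs : IsTempered s) (k : ℕ) {τ : ℝ} (hτ : 0 < τ) :
    𝓕 (dist (heatConv s k τ)) =
      TemperedDistribution.smulLeftCLM ℂ (heatSymbol k τ) (𝓕 (dist s)) := by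
  obtain ⟨K, hK, hK'⟩ := exists_schwartz_eq_heatKernel k hτ
  have h := fourier_dist_convolution hs K
  rw [hK, hK'] at h
  exact h

/-! ### Temperature derivatives -/

theorem heatKernel_zero_sq {β : ℝ} (hβ : 0 < β) : heatKernel 0 (β ^ 2) = boltzmann β := by
  ext z
  have hpos : 0 < Real.pi * β ^ 2 := by positivity
  -- Normalised as exp(-πbx²) with b = πβ², the form of the Gaussian transform formula; √b = β√π is
  -- the kernel's normalisation.
  have h1 : heatSymbol 0 (β ^ 2) = fun x : ℝ =>
      Complex.exp (-(Real.pi : ℂ) * ((Real.pi * β ^ 2 : ℝ) : ℂ) * (x : ℂ) ^ 2) := by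
    ext ν
    simp only [heatSymbol, mul_zero, pow_zero, one_mul, Complex.ofReal_exp]
    congr 1
    push_cast
    ring
  have h2 : (((Real.pi * β ^ 2 : ℝ) : ℂ)) ^ (1 / 2 : ℂ) = ((β * Real.sqrt Real.pi : ℝ) : ℂ) := by
    have h3 : ((1 / 2 : ℝ) : ℂ) = (1 / 2 : ℂ) := by push_cast; rfl
    rw [← h3, ← Complex.ofReal_cpow hpos.le, ← Real.sqrt_eq_rpow, Real.sqrt_mul Real.pi_pos.le,
      Real.sqrt_sq hβ.le, mul_comm]
  rw [heatKernel, h1, Real.fourierInv_eq_fourier_neg,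
    fourier_gaussian_pi (by rwa [Complex.ofReal_re])]
  simp only
  rw [h2, boltzmann]
  push_cast
  congr 2
  have hpi : (Real.pi : ℂ) ≠ 0 := by exact_mod_cast Real.pi_ne_zero
  have hβ0 : (β : ℂ) ≠ 0 := by exact_mod_cast hβ.ne'
  field_simp

theorem fourier_heatKernel (k : ℕ) {τ : ℝ} (hτ : 0 < τ) :
    𝓕 (heatKernel k τ) = heatSymbol k τ := by
  obtain ⟨K, hK, hK'⟩ := exists_schwartz_eq_heatKernel k hτ
  rw [← hK, ← SchwartzMap.fourier_coe, hK']

theorem beta_pos {kB A T₀ T : ℝ} (hkB : 0 < kB) (hA : 0 < A) (hT : T₀ < T) :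
    0 < beta kB A T₀ T :=
  Real.sqrt_pos.2 (div_pos (mul_pos hkB (sub_pos.2 hT)) hA)

theorem beta_sq {kB A T₀ T : ℝ} (hkB : 0 < kB) (hA : 0 < A) (hT : T₀ < T) :
    beta kB A T₀ T ^ 2 = kB / A * (T - T₀) := by
  rw [beta, Real.sq_sqrt (div_pos (mul_pos hkB (sub_pos.2 hT)) hA).le]
  ring

theorem kernelT_eq_heatKernel {kB A T₀ T : ℝ} (hkB : 0 < kB) (hA : 0 < A) (hT : T₀ < T) :
    kernelT kB A T₀ T = heatKernel 0 (kB / A * (T - T₀)) := by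
  rw [kernelT, ← heatKernel_zero_sq (beta_pos hkB hA hT), beta_sq hkB hA hT]

theorem boltzmann_neg (β z : ℝ) : boltzmann β (-z) = boltzmann β z := by
  simp [boltzmann, neg_div]

theorem solbrig_eq (β z x : ℝ) :
    solbrig β z x = boltzmann β (z - x) - boltzmann β (z + x) := by
  simp only [solbrig, boltzmann]
  push_cast
  ring

/-- The origin of Solbrig's kernel: folding the convolution onto x > 0 pairs the Gaussian at z - x
with minus the one at z + x. -/
theorem integral_mul_boltzmann {g : ℝ → ℂ} {β z : ℝ}
    (h : Integrable fun y => oddExt g y * boltzmann β (z - y)) :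
    ∫ y, oddExt g y * boltzmann β (z - y) = ∫ x in Set.Ioi (0 : ℝ), g x * solbrig β z x := by
  rw [integral_eq_integral_Ioi_add_neg h]
  refine setIntegral_congr_fun measurableSet_Ioi fun x hx => ?_
  simp only [oddExt_neg, oddExt_of_pos g (Set.mem_Ioi.1 hx), solbrig_eq, sub_neg_eq_add]
  ring

theorem sT_eq_heatConv {σ : ℝ → ℂ} (hσ : IsTempered (ferran σ)) {kB A T₀ T : ℝ} (hkB : 0 < kB)
    (hA : 0 < A) (hT : T₀ < T) (z : ℝ) :
    sT σ kB A T₀ T z = heatConv (ferran σ) 0 (kB / A * (T - T₀)) z := by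
  have hτ : 0 < kB / A * (T - T₀) := mul_pos (div_pos hkB hA) (sub_pos.2 hT)
  have hInt := fun z => integrable_mul_heatKernel hσ 0 hτ z
  rw [heatConv, sT]
  rw [← beta_sq hkB hA hT, heatKernel_zero_sq (beta_pos hkB hA hT)] at hInt ⊢
  set β := beta kB A T₀ T
  -- Solbrig's kernel is odd in z, so the half-line integral is its own odd extension; this settles
  -- z < 0.
  have hsol : ∀ x, solbrig β (-z) x = -solbrig β z x := fun x => by
    rw [solbrig_eq, solbrig_eq, ← boltzmann_neg β (-z - x), ← boltzmann_neg β (-z + x)]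
    ring_nf
  rw [ferran, ferran, integral_mul_boltzmann (hInt z), oddExt]
  split_ifs with h1 h2
  · have hz : (z : ℂ) ≠ 0 := by exact_mod_cast h1.ne'
    rw [broadened]
    field_simp
  · subst h2
    have : ∀ x, solbrig β 0 x = 0 := fun x => by
      rw [solbrig_eq, zero_sub, zero_add, boltzmann_neg, sub_self]
    simp [this]
  · have hz : (z : ℂ) ≠ 0 := by exact_mod_cast h2
    rw [broadened]
    simp_rw [hsol, mul_neg]
    rw [integral_neg]
    push_cast
    field_simp

theorem hasDerivAt_comp_affine {G : ℕ → ℝ → ℂ}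
    (hG : ∀ k τ, 0 < τ → HasDerivAt (G k) (G (k + 1) τ) τ) {c T₀ T : ℝ} (hc : 0 < c)
    (hT : T₀ < T) (k : ℕ) :
    HasDerivAt (fun T => (c : ℂ) ^ k * G k (c * (T - T₀)))
      ((c : ℂ) ^ (k + 1) * G (k + 1) (c * (T - T₀))) T := by
  have h1 : HasDerivAt (fun T => c * (T - T₀)) c T := by
    simpa using ((hasDerivAt_id T).sub_const T₀).const_mul c
  have h2 := (hG k _ (mul_pos hc (sub_pos.2 hT))).scomp T h1
  refine (h2.const_mul _).congr_deriv ?_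
  rw [Complex.real_smul]
  ring

theorem iteratedDeriv_eq_of_hasDerivAt {G : ℕ → ℝ → ℂ}
    (hG : ∀ k τ, 0 < τ → HasDerivAt (G k) (G (k + 1) τ) τ) {c T₀ : ℝ} (hc : 0 < c)
    {f : ℝ → ℂ} (hf : ∀ T, T₀ < T → f T = G 0 (c * (T - T₀))) (k : ℕ) :
    ∀ T, T₀ < T → iteratedDeriv k f T = (c : ℂ) ^ k * G k (c * (T - T₀)) := by
  induction k with
  | zero =>
    intro T hT
    simpa using hf T hT
  | succ k ih =>
    intro T hT
    rw [iteratedDeriv_succ]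
    refine ((hasDerivAt_comp_affine hG hc hT k).congr_of_eventuallyEq ?_).deriv
    -- The formula is known only for T' > T₀, an open condition, which is enough for a derivative at
    -- T.
    filter_upwards [Ioi_mem_nhds hT] with T' hT'
    exact ih T' hT'

/-- Induction on the order of smoothness for all k at once, since differentiating the k-th function
leads to the next. -/
theorem contDiffOn_of_hasDerivAt {G : ℕ → ℝ → ℂ}
    (hG : ∀ k τ, 0 < τ → HasDerivAt (G k) (G (k + 1) τ) τ) {c T₀ : ℝ} (hc : 0 < c)
    {f : ℝ → ℂ} (hf : ∀ T, T₀ < T → f T = G 0 (c * (T - T₀))) :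
    ContDiffOn ℝ ∞ f (Set.Ioi T₀) := by
  have h : ∀ n k : ℕ, ContDiffOn ℝ n (fun T => (c : ℂ) ^ k * G k (c * (T - T₀)))
      (Set.Ioi T₀) := by
    intro n
    induction n with
    | zero =>
      intro k
      rw [Nat.cast_zero, contDiffOn_zero]
      exact fun T hT => (hasDerivAt_comp_affine hG hc hT k).continuousAt.continuousWithinAt
    | succ n ih =>
      intro k
      rw [Nat.cast_succ, contDiffOn_succ_iff_deriv_of_isOpen isOpen_Ioi]
      refine ⟨fun T hT => (hasDerivAt_comp_affine hG hc hT
        k).differentiableAt.differentiableWithinAt, by simp, (ih (k + 1)).congr fun T hT => ?_⟩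
      exact (hasDerivAt_comp_affine hG hc hT k).deriv
  refine contDiffOn_infty.2 fun n => (h n 0).congr fun T hT => ?_
  simpa using hf T hT

theorem tempDeriv_kernelT {kB A T₀ T : ℝ} (hkB : 0 < kB) (hA : 0 < A) (hT : T₀ < T) (k : ℕ) :
    tempDeriv k (kernelT kB A T₀) T =
      fun z => ((kB / A : ℝ) : ℂ) ^ k * heatKernel k (kB / A * (T - T₀)) z := by
  ext z
  exact iteratedDeriv_eq_of_hasDerivAt (G := fun k τ => heatKernel k τ z)
    (fun k τ hτ => hasDerivAt_heatKernel k hτ z) (div_pos hkB hA)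
    (fun T hT => congrFun (kernelT_eq_heatKernel hkB hA hT) z) k T hT

theorem fourier_kernelT {kB A T₀ T : ℝ} (hkB : 0 < kB) (hA : 0 < A) (hT : T₀ < T) :
    𝓕 (kernelT kB A T₀ T) = heatSymbol 0 (kB / A * (T - T₀)) := by
  rw [kernelT_eq_heatKernel hkB hA hT,
    fourier_heatKernel 0 (mul_pos (div_pos hkB hA) (sub_pos.2 hT))]

theorem tempDeriv_fourier_kernelT {kB A T₀ T : ℝ} (hkB : 0 < kB) (hA : 0 < A) (hT : T₀ < T)
    (k : ℕ) :
    tempDeriv k (fun T' => 𝓕 (kernelT kB A T₀ T')) T =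
      fun ν => ((kB / A : ℝ) : ℂ) ^ k * heatSymbol k (kB / A * (T - T₀)) ν := by
  ext ν
  exact iteratedDeriv_eq_of_hasDerivAt (G := fun k τ => heatSymbol k τ ν)
    (fun k τ _ => hasDerivAt_heatSymbol k τ ν) (div_pos hkB hA)
    (fun T hT => congrFun (fourier_kernelT hkB hA hT) ν) k T hT

theorem tempDeriv_sT {σ : ℝ → ℂ} (hσ : IsTempered (ferran σ)) {kB A T₀ T : ℝ} (hkB : 0 < kB)
    (hA : 0 < A) (hT : T₀ < T) (k : ℕ) :
    tempDeriv k (sT σ kB A T₀) T =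
      fun z => ((kB / A : ℝ) : ℂ) ^ k * heatConv (ferran σ) k (kB / A * (T - T₀)) z := by
  ext z
  exact iteratedDeriv_eq_of_hasDerivAt (G := fun k τ => heatConv (ferran σ) k τ z)
    (fun k τ hτ => hasDerivAt_heatConv hσ k hτ z) (div_pos hkB hA)
    (fun T hT => sT_eq_heatConv hσ hkB hA hT z) k T hT

theorem heatSymbol_zero_beta {kB A T₀ T : ℝ} (hkB : 0 < kB) (hA : 0 < A) (hT : T₀ < T) (ν : ℝ) :
    heatSymbol 0 (kB / A * (T - T₀)) ν =
      ((Real.exp (-(Real.pi * beta kB A T₀ T * ν) ^ 2) : ℝ) : ℂ) := by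
  rw [heatSymbol, mul_zero, pow_zero, one_mul, ← beta_sq hkB hA hT]
  congr 3
  ring

theorem heatSymbol_eq_mul (k : ℕ) (τ ν : ℝ) :
    heatSymbol k τ ν =
      (Complex.I * (Real.pi : ℂ) * (ν : ℂ)) ^ (2 * k) * heatSymbol 0 τ ν := by
  simp [heatSymbol]

/-! ### Series of resonances -/

theorem neg_conj_mem_slitPlane {q : ℂ} (hq : -q ∈ Complex.slitPlane) :
    -conj q ∈ Complex.slitPlane := by
  rw [Complex.mem_slitPlane_iff] at hq ⊢
  simpa using hq

theorem norm_conj_sub (q : ℂ) (z : ℝ) : ‖(z : ℂ) - conj q‖ = ‖(z : ℂ) - q‖ := by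
  rw [← Complex.norm_conj ((z : ℂ) - q), map_sub, Complex.conj_ofReal]

theorem norm_oddExt_of_ne_zero (g : ℝ → ℂ) {x : ℝ} (hx : x ≠ 0) :
    ‖oddExt g x‖ = ‖g |x|‖ := by
  rw [oddExt_eq_sign_mul, norm_mul, Complex.norm_real]
  rcases Real.sign_apply_eq_of_ne_zero x hx with h | h <;> simp [h]

/-- The modulus is even away from 0, so the weighted L¹ norm is twice the quantity assumed summable.
-/
theorem integral_norm_weight_resonance (m : ℕ) (r q : ℂ) :
    ∫ x : ℝ, ‖((((1 + |x|) ^ m)⁻¹ : ℝ) : ℂ) * (r * oddExt (fun z => 1 / ((z : ℂ) - q)) x)‖ =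
      2 * (‖r‖ * ∫ z in Set.Ioi (0 : ℝ), ((1 + z) ^ m)⁻¹ * ‖(z : ℂ) - q‖⁻¹) := by
  have h := integral_comp_abs (f := fun z : ℝ => ‖r‖ * (((1 + z) ^ m)⁻¹ * ‖(z : ℂ) - q‖⁻¹))
  rw [← integral_const_mul, ← h]
  refine integral_congr_ae ?_
  filter_upwards [compl_mem_ae_iff.2 (measure_singleton (0 : ℝ))] with x hx
  rw [norm_weight_mul, norm_mul, norm_oddExt_of_ne_zero _ hx, norm_div, norm_one, one_div]
  ring

/-- A resonance decays like (1 + |x|)⁻¹; one further power of the weight makes it integrable, hence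
m ≥ 1. -/
theorem integrable_weight_resonance {m : ℕ} (hm : 1 ≤ m) (r : ℂ) {q : ℂ}
    (hq : -q ∈ Complex.slitPlane) :
    Integrable fun x : ℝ => ((((1 + |x|) ^ m)⁻¹ : ℝ) : ℂ) *
      (r * oddExt (fun z => 1 / ((z : ℂ) - q)) x) := by
  obtain ⟨c, hc, hcle⟩ := exists_mul_one_add_le_norm_add hq
  have hmeas := measurable_oddExt_resonance q
  have h1 : Integrable fun x : ℝ => ((((1 + |x|) ^ 1)⁻¹ : ℝ) : ℂ) *
      (r * oddExt (fun z => 1 / ((z : ℂ) - q)) x) := by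
    refine (integrable_inv_one_add_abs_sq.const_mul (‖r‖ * c⁻¹)).mono'
      ((measurable_weight 1).mul (hmeas.const_mul r)).aestronglyMeasurable
      (Eventually.of_forall fun x => ?_)
    have h2 := hcle |x| (abs_nonneg x)
    have hx : 0 < 1 + |x| := by positivity
    have h3 : ‖oddExt (fun z => 1 / ((z : ℂ) - q)) x‖ ≤ c⁻¹ * (1 + |x|)⁻¹ := by
      refine (norm_oddExt_le _ x).trans ?_
      rw [norm_div, norm_one, one_div, ← mul_inv, sub_eq_add_neg]
      exact inv_anti₀ (by positivity) h2
    rw [norm_weight_mul, norm_mul, pow_one]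
    calc (1 + |x|)⁻¹ * (‖r‖ * ‖oddExt (fun z => 1 / ((z : ℂ) - q)) x‖)
        ≤ (1 + |x|)⁻¹ * (‖r‖ * (c⁻¹ * (1 + |x|)⁻¹)) := by gcongr
      _ = ‖r‖ * c⁻¹ * ((1 + |x|) ^ 2)⁻¹ := by rw [pow_two, mul_inv]; ring
  exact integrable_weight_of_le hm h1

theorem hasSum_fourier_resonance {ι : Type*} [Countable ι] {r p : ι → ℂ}
    (hp : ∀ j, -p j ∈ Complex.slitPlane) {m : ℕ} (hm : 1 ≤ m)
    (hsum : Summable fun j =>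
      ‖r j‖ * ∫ z in Set.Ioi (0 : ℝ), ((1 + z) ^ m)⁻¹ * ‖(z : ℂ) - p j‖⁻¹) :
    IsTempered (oddExt fun z => ∑' j, r j / ((z : ℂ) - p j)) ∧
      HasSum (fun j => r j • dist (Vhat (p j)))
        (𝓕 (dist (oddExt fun z => ∑' j, r j / ((z : ℂ) - p j)))) := by
  set F : ι → ℝ → ℂ := fun j x => r j * oddExt (fun z => 1 / ((z : ℂ) - p j)) x with hF
  have h1 : ∀ j, Integrable fun x : ℝ => ((((1 + |x|) ^ m)⁻¹ : ℝ) : ℂ) * F j x :=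
    fun j => integrable_weight_resonance hm (r j) (hp j)
  have h2 : Summable fun j => ∫ x : ℝ, ‖((((1 + |x|) ^ m)⁻¹ : ℝ) : ℂ) * F j x‖ := by
    simp_rw [hF, integral_norm_weight_resonance]
    exact hsum.mul_left 2
  -- A scalar factor passes through `tsum` without summability, so no pointwise convergence is
  -- needed.
  have h3 : (oddExt fun z => ∑' j, r j / ((z : ℂ) - p j)) = fun x => ∑' j, F j x := by
    ext x
    rw [oddExt_eq_sign_mul, ← tsum_mul_left]
    refine tsum_congr fun j => ?_
    rw [hF]
    simp only [oddExt_eq_sign_mul]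
    ring
  rw [h3]
  refine ⟨isTempered_tsum h1 h2, ?_⟩
  have h4 := (hasSum_dist h1 h2).map (fourierCLM ℂ 𝓢'(ℝ, ℂ)) (fourierCLM ℂ 𝓢'(ℝ, ℂ)).continuous
  rw [fourierCLM_apply] at h4
  convert h4 using 1
  ext1 j
  have h5 := fourier_dist_resonance (hp j)
  rw [Function.comp_apply, fourierCLM_apply, hF]
  simp only
  rw [dist_const_mul (isTempered_oddExt_resonance (hp j)), fourier_smul, h5.2]

theorem reConj_tsum_resonance {ι : Type*} (r p : ι → ℂ) (z : ℝ) :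
    reConj (fun w => ∑' j, r j / (w - p j)) (z : ℂ) =
      (1 / 2 : ℂ) * (∑' j, r j / ((z : ℂ) - p j) +
        ∑' j, conj (r j) / ((z : ℂ) - conj (p j))) := by
  rw [reConj, Complex.conj_ofReal, Complex.conj_tsum]
  simp only [map_div₀, map_sub, Complex.conj_ofReal]
  ring

end WMP

/-! ### Assembly of both parts of the theorem -/

theorem theorem5 {ι : Type*} [Countable ι]
    (r p : ι → ℂ) (a : ℤ → ℂ) (N : ℕ) (σ₀ : ℝ → ℂ)
    (hp : ∀ j, -p j ∈ Complex.slitPlane)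
    (m : ℕ) (hm : 1 ≤ m)
    (hsum : Summable fun j =>
      ‖r j‖ * ∫ z in Set.Ioi (0 : ℝ), ((1 + z) ^ m)⁻¹ * ‖(z : ℂ) - p j‖⁻¹)
    (hσ₀ : ∀ z : ℝ, 0 < z → (z : ℂ) ^ 2 * σ₀ z =
      WMP.reConj (fun w => ∑' j, r j / (w - p j)) (z : ℂ) +
        ∑ n ∈ Finset.range (N + 1), a ((n : ℤ) - 2) * (z : ℂ) ^ n)
    (kB A T₀ : ℝ) (hkB : 0 < kB) (hA : 0 < A) :
    -- the Fourier transform of the Ferran representation of `σ₀`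
    (WMP.IsTempered (WMP.ferran σ₀) ∧
      Summable (fun j => r j • WMP.dist (WMP.Vhat (p j))) ∧
      Summable (fun j => conj (r j) • WMP.dist (WMP.Vhat (conj (p j)))) ∧
      𝓕 (WMP.dist (WMP.ferran σ₀)) =
        (1 / 2 : ℂ) • ((∑' j, r j • WMP.dist (WMP.Vhat (p j))) +
          ∑' j, conj (r j) • WMP.dist (WMP.Vhat (conj (p j)))) +
        ∑ n ∈ Finset.range (N + 1), a ((n : ℤ) - 2) • WMP.Fhat n) ∧
    -- the Fourier transforms of the monomials
    (∀ n : ℕ, WMP.IsTempered (WMP.oddExt fun z => (z : ℂ) ^ n) ∧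
      𝓕 (WMP.dist (WMP.oddExt fun z => (z : ℂ) ^ n)) = WMP.Fhat n) ∧
    -- the Fourier transforms of the resonances, as distributions and as improper integrals
    (∀ q : ℂ, -q ∈ Complex.slitPlane →
      WMP.IsTempered (WMP.oddExt fun z => 1 / ((z : ℂ) - q)) ∧
      WMP.IsTempered (WMP.Vhat q) ∧
      𝓕 (WMP.dist (WMP.oddExt fun z => 1 / ((z : ℂ) - q))) = WMP.dist (WMP.Vhat q) ∧
      ∀ ν : ℝ, Tendsto (fun R : ℝ => ∫ t in (-R)..R,
          WMP.oddExt (fun z => 1 / ((z : ℂ) - q)) t *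
            Complex.exp (-Complex.I * 2 * (Real.pi : ℂ) * (ν : ℂ) * (t : ℂ)))
        atTop (𝓝 (WMP.Vhat q ν))) ∧
    -- the temperature derivatives as convolutions
    (∀ z : ℝ, ContDiffOn ℝ ∞ (fun T => WMP.sT σ₀ kB A T₀ T z) (Set.Ioi T₀)) ∧
    ∀ (k : ℕ) (T : ℝ), T₀ < T →
      ConvolutionExists (WMP.ferran σ₀) (WMP.tempDeriv k (WMP.kernelT kB A T₀) T)
        (ContinuousLinearMap.mul ℂ ℂ) volume ∧
      WMP.tempDeriv k (WMP.sT σ₀ kB A T₀) T =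
        convolution (WMP.ferran σ₀) (WMP.tempDeriv k (WMP.kernelT kB A T₀) T)
          (ContinuousLinearMap.mul ℂ ℂ) volume ∧
      -- the temperature derivatives of the transformed kernel
      (∀ ν : ℝ,
        WMP.tempDeriv k (fun T' => 𝓕 (WMP.kernelT kB A T₀ T')) T ν =
          ((kB / A : ℝ) : ℂ) ^ k * (Complex.I * (Real.pi : ℂ) * (ν : ℂ)) ^ (2 * k) *
            𝓕 (WMP.kernelT kB A T₀ T) ν ∧
        𝓕 (WMP.kernelT kB A T₀ T) ν =
          ((Real.exp (-(Real.pi * WMP.beta kB A T₀ T * ν) ^ 2) : ℝ) : ℂ)) ∧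
      -- the Fourier transform of the temperature derivatives, and its inversion
      WMP.IsTempered (WMP.tempDeriv k (WMP.sT σ₀ kB A T₀) T) ∧
      Function.HasTemperateGrowth
        (WMP.tempDeriv k (fun T' => 𝓕 (WMP.kernelT kB A T₀ T')) T) ∧
      𝓕 (WMP.dist (WMP.tempDeriv k (WMP.sT σ₀ kB A T₀) T)) =
        TemperedDistribution.smulLeftCLM ℂ
          (WMP.tempDeriv k (fun T' => 𝓕 (WMP.kernelT kB A T₀ T')) T)
          (𝓕 (WMP.dist (WMP.ferran σ₀))) ∧
      WMP.dist (WMP.tempDeriv k (WMP.sT σ₀ kB A T₀) T) =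
        𝓕⁻ (TemperedDistribution.smulLeftCLM ℂ (fun ν : ℝ =>
          ((kB / A : ℝ) : ℂ) ^ k * (Complex.I * (Real.pi : ℂ) * (ν : ℂ)) ^ (2 * k) *
            ((Real.exp (-(Real.pi * WMP.beta kB A T₀ T * ν) ^ 2) : ℝ) : ℂ))
          (𝓕 (WMP.dist (WMP.ferran σ₀)))) := by
  obtain ⟨hT1, hS1⟩ := WMP.hasSum_fourier_resonance hp hm hsum
  -- Conjugate poles are equally far from every real z, so the summability hypothesis carries over.
  obtain ⟨hT2, hS2⟩ := WMP.hasSum_fourier_resonance (r := fun j => conj (r j))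
    (p := fun j => conj (p j)) (fun j => WMP.neg_conj_mem_slitPlane (hp j)) hm (by
      simpa only [WMP.norm_conj_sub, Complex.norm_conj] using hsum)
  have hT3 : ∀ n ∈ Finset.range (N + 1), WMP.IsTempered fun x =>
      a ((n : ℤ) - 2) * WMP.oddExt (fun z => (z : ℂ) ^ n) x := fun n _ =>
    (WMP.isTempered_oddExt_pow n).const_mul _
  have hferran : WMP.ferran σ₀ = fun x =>
      (1 / 2 : ℂ) * (WMP.oddExt (fun z => ∑' j, r j / ((z : ℂ) - p j)) x +
        WMP.oddExt (fun z => ∑' j, conj (r j) / ((z : ℂ) - conj (p j))) x) +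
      ∑ n ∈ Finset.range (N + 1), a ((n : ℤ) - 2) * WMP.oddExt (fun z => (z : ℂ) ^ n) x := by
    ext x
    -- The multipole formula is assumed only for positive arguments: it is used at |x|, and at 0 all
    -- odd extensions vanish.
    rcases eq_or_ne x 0 with rfl | hx
    · simp [WMP.ferran, WMP.oddExt_zero]
    · simp only [WMP.ferran, WMP.oddExt_eq_sign_mul]
      rw [hσ₀ _ (abs_pos.2 hx), WMP.reConj_tsum_resonance, mul_add (Real.sign x : ℂ),
        Finset.mul_sum]
      congr 1
      · ring
      · exact Finset.sum_congr rfl fun n _ => by ring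
  have hT12 := (hT1.add hT2).const_mul (1 / 2 : ℂ)
  have hTs : WMP.IsTempered (WMP.ferran σ₀) := by
    rw [hferran]
    exact hT12.add (WMP.IsTempered.sum _ hT3)
  refine ⟨⟨hTs, hS1.summable, hS2.summable, ?_⟩, fun n => ⟨WMP.isTempered_oddExt_pow n,
    WMP.fourier_dist_oddExt_pow n⟩, fun q hq => ⟨WMP.isTempered_oddExt_resonance hq,
    (WMP.fourier_dist_resonance hq).1, (WMP.fourier_dist_resonance hq).2,
    WMP.tendsto_truncFourier_resonance hq⟩, fun z => ?_, fun k T hT => ?_⟩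
  · rw [hferran, WMP.dist_add hT12 (WMP.IsTempered.sum _ hT3),
      WMP.dist_const_mul (hT1.add hT2), WMP.dist_add hT1 hT2, WMP.dist_sum _ hT3,
      FourierTransform.fourier_add, FourierTransform.fourier_smul, FourierTransform.fourier_add,
      hS1.tsum_eq, hS2.tsum_eq]
    congr 1
    rw [← fourierCLM_apply (R := ℂ), map_sum]
    refine Finset.sum_congr rfl fun n _ => ?_
    rw [WMP.dist_const_mul (WMP.isTempered_oddExt_pow n), map_smul, fourierCLM_apply,
      WMP.fourier_dist_oddExt_pow]
  · exact WMP.contDiffOn_of_hasDerivAt (G := fun k τ => WMP.heatConv (WMP.ferran σ₀) k τ z)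
      (fun k τ hτ => WMP.hasDerivAt_heatConv hTs k hτ z) (div_pos hkB hA)
      fun T hT => WMP.sT_eq_heatConv hTs hkB hA hT z
  · have hτ : 0 < kB / A * (T - T₀) := mul_pos (div_pos hkB hA) (sub_pos.2 hT)
    have hsymbol : (fun ν : ℝ => ((kB / A : ℝ) : ℂ) ^ k *
        (Complex.I * (Real.pi : ℂ) * (ν : ℂ)) ^ (2 * k) *
          ((Real.exp (-(Real.pi * WMP.beta kB A T₀ T * ν) ^ 2) : ℝ) : ℂ)) =
        fun ν => ((kB / A : ℝ) : ℂ) ^ k * WMP.heatSymbol k (kB / A * (T - T₀)) ν := by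
      ext ν
      rw [WMP.heatSymbol_eq_mul, WMP.heatSymbol_zero_beta hkB hA hT, mul_assoc]
    have hgrowth := WMP.hasTemperateGrowth_heatSymbol k hτ
    have hfourier : 𝓕 (WMP.dist fun z => ((kB / A : ℝ) : ℂ) ^ k *
        WMP.heatConv (WMP.ferran σ₀) k (kB / A * (T - T₀)) z) =
        TemperedDistribution.smulLeftCLM ℂ
          (fun ν => ((kB / A : ℝ) : ℂ) ^ k * WMP.heatSymbol k (kB / A * (T - T₀)) ν)
          (𝓕 (WMP.dist (WMP.ferran σ₀))) := by
      rw [WMP.dist_const_mul (WMP.isTempered_heatConv hTs k hτ), fourier_smul,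
        WMP.fourier_dist_heatConv hTs k hτ]
      -- The chain-rule factor (k_B/A)^k is absorbed into the multiplier, whose temperate growth
      -- makes this legitimate.
      have h := TemperedDistribution.smulLeftCLM_smul (F := ℂ) hgrowth (((kB / A : ℝ) : ℂ) ^ k)
      exact (congrArg (fun u => u (𝓕 (WMP.dist (WMP.ferran σ₀)))) h).symm
    rw [hsymbol, WMP.tempDeriv_fourier_kernelT hkB hA hT, WMP.tempDeriv_sT hTs hkB hA hT,
      WMP.tempDeriv_kernelT hkB hA hT, WMP.fourier_kernelT hkB hA hT]
    refine ⟨fun z => ?_, ?_, fun ν => ⟨?_, WMP.heatSymbol_zero_beta hkB hA hT ν⟩,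
      (WMP.isTempered_heatConv hTs k hτ).const_mul _, ?_, hfourier, ?_⟩
    · refine ((WMP.integrable_mul_heatKernel hTs k hτ z).const_mul
        (((kB / A : ℝ) : ℂ) ^ k)).congr (Eventually.of_forall fun y => ?_)
      simp only [ContinuousLinearMap.mul_apply']
      ring
    · ext z
      rw [convolution, WMP.heatConv, ← integral_const_mul]
      congr 1
      ext y
      simp only [ContinuousLinearMap.mul_apply']
      ring
    · simp only [WMP.heatSymbol_eq_mul k]
      exact (mul_assoc _ _ _).symm
    · exact (Function.HasTemperateGrowth.const _).mul hgrowth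
    · rw [← hfourier, fourierInv_fourier_eq]
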